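/- Let $R$ be a complete discrete valuation ring with maximal ideal $\mathfrak p$, fraction field $K$ and finite residue field $k$ of odd order $q$ (for instance the completion $\mathcal O_{\mathfrak p}$ of a Dedekind domain at a prime $\mathfrak p\nmid 2$ with finite residue field), and let $B$ be a quaternion algebra over $K$. Fix a uniformizer $\pi$ of $R$, an element $\delta\in R$ whose class in $k$ is not a square, and elements $\alpha_0,\alpha_1,\beta_0,\beta_1,\mu,\nu\in R$ such that $\alpha_0^2-\alpha_1^2=\pi$, $\beta_0^2+\beta_1^2=\delta$, $\mu^2=-1$ if $-1$ is a square in $k$, and $\nu^2=-\delta$ if $-1$ is not a square in $k$. Let $\varepsilon\in\{1,-1\}$ be the sign with $\alpha_0\equiv\varepsilon\alpha_1\pmod{\mathfrak p}$. For $a,b\in R$, a basis $\{1,e_1,e_2,e_3\}$ of an $R$-order $\mathcal R\subset B$ is *good* for the ternary form $\langle 1,a,b\rangle$ if $$e_1^2=-ab,\quad e_2^2=-b,\quad e_3^2=-a,\quad e_1e_2=-be_3=-e_2e_1,\quad e_2e_3=-e_1=-e_3e_2,\quad e_3e_1=-ae_2=-e_1e_3,$$ and *quasi-good* for $\langle 1,a,b\rangle$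 if there is a good basis $\{1,\tilde e_1,\tilde e_2,\tilde e_3\}$ of $\mathcal R$ for $\langle 1,a,b\rangle$ with $\tilde e_i\equiv e_i \pmod{\mathfrak p\mathcal R}$ for $1\le i\le 3$. Let $\mathcal R$ be an order with a quasi-good basis $\{1,e_1,e_2,e_3\}$ for one of the forms $f$ below (so that $\mathcal R$ is a Bass order corresponding to $f$), and let $\mathcal R'=\langle 1,d_1,d_2,d_3\rangle_R$ be the maximal suborder corresponding to a form $g$ beneath $f$, constructed as follows. * **A1→A1**: $f=\langle1,-1,\pi^s\rangle$, $g=\langle1,-1,\pi^{s+1}\rangle$, $s\ge0$: $d_1=\alpha_0e_1+\alpha_1e_2$, $d_2=\alpha_1e_1+\alpha_0e_2$, $d_3=e_3$. * **A1→A2**: $f=\langle1,-1,1\rangle$, $g=\langle1,-\delta,\pi^2\rangle$: $d_1=\pi(\beta_1e_1-\beta_0e_3)$, $d_2=\pi e_2$, $d_3=\beta_0e_1+\beta_1e_3$. * **A1→B**: $f=\langle1,-1,\pi\rangle$. If $-1$ is a square in $k$, $g=\langle1,\pi,\pi\rangle$: $d_1=\mu\pi e_3$, $d_2=\mu e_1$,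 $d_3=e_2$. Otherwise $g=\langle1,\pi,\delta\pi\rangle$: $d_1=\nu\pi e_3$, $d_2=\nu e_1$, $d_3=e_2$. * **A2→A2**: $f=\langle1,-\delta,\pi^s\rangle$, $g=\langle1,-\delta,\pi^{s+2}\rangle$, $s\ge1$: $d_1=\pi e_1$, $d_2=\pi e_2$, $d_3=e_3$. * **A2→B**: $f=\langle1,-\delta,\pi\rangle$. If $-1$ is a square in $k$, $g=\langle1,\pi,\delta\pi\rangle$: $d_1=\mu\pi e_3$, $d_2=\mu e_1$, $d_3=e_2$. Otherwise $g=\langle1,\pi,\pi\rangle$: $d_1=\nu^{-1}\pi e_3$, $d_2=\nu^{-1}e_1$, $d_3=e_2$. * **B→C**: * $f=\langle1,\pi,\pi\rangle$, $g=\langle1,\pi,\pi^2\rangle$: $d_1=\pi e_2$, $d_2=e_1$, $d_3=e_3$; * $f=\langle1,\pi,\pi\rangle$, $g=\langle1,\delta\pi,\pi^2\rangle$: $d_1=\pi(-\beta_1e_2+\beta_0e_3)$, $d_2=e_1$, $d_3=\beta_0e_2+\beta_1e_3$; * $f=\langle1,\pi,\delta\pi\rangle$, $g=\langle1,\pi,\delta\pi^2\rangle$: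 $d_1=\pi e_2$, $d_2=e_1$, $d_3=e_3$; * $f=\langle1,\pi,\delta\pi\rangle$, $g=\langle1,\delta\pi,\delta\pi^2\rangle$: $d_1=\delta\pi e_3$, $d_2=e_1$, $d_3=e_2$. * **C→C**, $s\ge2$: * $f=\langle1,\pi,\pi^s\rangle$, $g=\langle1,\pi,\pi^{s+1}\rangle$, and $f=\langle1,\pi,\delta\pi^s\rangle$, $g=\langle1,\pi,\delta\pi^{s+1}\rangle$: $d_1=\pi e_2$, $d_2=e_1$, $d_3=e_3$; * $f=\langle1,\delta\pi,\pi^s\rangle$, $g=\langle1,\delta\pi,\delta\pi^{s+1}\rangle$: $d_1=\delta\pi e_2$, $d_2=e_1$, $d_3=e_3$; * $f=\langle1,\delta\pi,\delta\pi^s\rangle$, $g=\langle1,\delta\pi,\pi^{s+1}\rangle$: $d_1=\delta\pi e_2$, $d_2=\delta^{-1}e_1$, $d_3=e_3$. Let $a_1,\dots,a_q\in R$ represent the residue classes, with $a_1=1$, $a_2=-1$, $a_q=0$. Let $S=\{\tilde\gamma\in k\times k: 1-\delta\tilde\gamma_1^2+\tilde\gamma_2^2\ne0\}$ and for each $\tilde\gamma\in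 S$ let $\gamma=(\gamma_1,\gamma_2)\in R\times R$ be any lift of $\tilde\gamma$. Then $\mathcal R'$ is indeed an order contained in $\mathcal R$, and the index $[\mathcal R^\times:\mathcal R'^\times]$ and a system of representatives for $\mathcal R'^\times\backslash\mathcal R^\times$ are as follows. | Case | Index | Representatives | |---|---|---| | A1→A1, $s=0$ | $q+1$ | $e_1$, $\;1+\frac{a_i}2(e_1-\varepsilon e_2)$ $(1\le i\le q)$ | | A1→A1, $s\ge1$ | $q$ | $1+\frac{a_i}2(e_1-\varepsilon e_2)$ $(1\le i\le q)$ | | A1→A2 | $q(q-1)$ | $e_2$, $\;1+\gamma_1(\beta_1e_1-\beta_0e_3)+\gamma_2e_2$ $(\tilde\gamma\in S)$ | | A1→B | $q-1$ | $1$, $\;a_i+e_3$ $(3\le i\le q)$ | | A2→A2 | $q^2$ | $1+a_ie_1+a_je_2$ $(1\le i,j\le q)$ | | A2→B | $q+1$ | $1$, $\;a_i+e_3$ $(1\le i\le q)$ | | B→C, $g\ne\langle1,\delta\pi,\delta\pi^2\rangle$ | $q$ | $1$, $\;a_i+e_2$ $(1\le i\le q-1)$ | | B→C, $g=\langle1,\delta\pi,\delta\pi^2\rangle$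 | $q$ | $1$, $\;a_i+e_3$ $(1\le i\le q-1)$ | | C→C | $q$ | $1$, $\;a_i+e_2$ $(1\le i\le q-1)$ | -/

import Mathlib

namespace BassOrder

open IsLocalRing

/-- An `R`-order of the `K`-algebra `B`: a subring containing `R` that is a full `R`-lattice. -/
def IsOrder {R : Type*} (K : Type*) {B : Type*} [CommRing R] [Field K] [Ring B]
    [Algebra R B] [Algebra K B] (O : Subalgebra R B) : Prop :=
  (Subalgebra.toSubmodule O).FG ∧ Submodule.span K (O : Set B) = ⊤

/-- `e = (e 0, e 1, e 2, e 3)` is an `R`-basis of `O` with `e 0 = 1`. -/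
structure IsUnitalBasis {R B : Type*} [CommRing R] [Ring B] [Algebra R B]
    (O : Subalgebra R B) (e : Fin 4 → B) : Prop where
  zero_eq : e 0 = 1
  linearIndependent : LinearIndependent R e
  span_eq : Submodule.span R (Set.range e) = Subalgebra.toSubmodule O

/-- `e` is a good basis of the order `O` for the ternary form `⟨1, a, b⟩`. The multiplication table
identifies `O` with the even Clifford algebra of that form, so that `O` corresponds to it. -/
structure IsGoodBasis {R B : Type*} [CommRing R] [Ring B] [Algebra R B]
    (O : Subalgebra R B) (a b : R) (e : Fin 4 → B) : Prop where
  basis : IsUnitalBasis O e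
  sq_one : e 1 * e 1 = algebraMap R B (-(a * b))
  sq_two : e 2 * e 2 = algebraMap R B (-b)
  sq_three : e 3 * e 3 = algebraMap R B (-a)
  one_two : e 1 * e 2 = -(b • e 3)
  two_three : e 2 * e 3 = -e 1
  three_one : e 3 * e 1 = -(a • e 2)
  two_one : e 2 * e 1 = b • e 3
  three_two : e 3 * e 2 = e 1
  one_three : e 1 * e 3 = a • e 2

/-- `e` is a quasi-good basis of `O` for the form `⟨1, a, b⟩`: a basis that is congruent modulo
`𝔭 O` to a good basis of `O`, where `𝔭` is the maximal ideal of `R`. -/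
def IsQuasiGoodBasis {R B : Type*} [CommRing R] [IsLocalRing R] [Ring B] [Algebra R B]
    (O : Subalgebra R B) (a b : R) (e : Fin 4 → B) : Prop :=
  IsUnitalBasis O e ∧ ∃ e' : Fin 4 → B, IsGoodBasis O a b e' ∧
    ∀ i, e' i - e i ∈ maximalIdeal R • Subalgebra.toSubmodule O

/-- The auxiliary elements of `R` used in the tables. -/
structure Params (R : Type*) where
  (π δ α₀ α₁ ε β₀ β₁ μ ν : R)

/-- The defining properties of the auxiliary elements. The sign `ε = ±1` is determined by `α₀` and
`α₁`, since exactly one of `α₀ - α₁` and `α₀ + α₁` is a unit. -/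
structure Params.Valid {R : Type*} [CommRing R] [IsLocalRing R] (P : Params R) : Prop where
  uniformizer : Irreducible P.π
  nonsquare : ¬ IsSquare (residue R P.δ)
  alpha : P.α₀ ^ 2 - P.α₁ ^ 2 = P.π
  sign : P.ε = 1 ∨ P.ε = -1
  sign_spec : P.α₀ - P.ε * P.α₁ ∈ maximalIdeal R
  beta : P.β₀ ^ 2 + P.β₁ ^ 2 = P.δ
  mu : IsSquare (-1 : ResidueField R) → P.μ ^ 2 = -1
  nu : ¬ IsSquare (-1 : ResidueField R) → P.ν ^ 2 = -P.δ

/-- The rows of the table of maximal suborders. The comment gives the form of the order and the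
form beneath it. -/
inductive Row
  /-- `⟨1, -1, π ^ s⟩` to `⟨1, -1, π ^ (s + 1)⟩` -/
  | A1A1 (s : ℕ)
  /-- `⟨1, -1, 1⟩` to `⟨1, -δ, π ^ 2⟩` -/
  | A1A2
  /-- `⟨1, -1, π⟩` to `⟨1, π, π⟩`, if `-1` is a square modulo `𝔭` -/
  | A1B
  /-- `⟨1, -1, π⟩` to `⟨1, π, δ π⟩`, if `-1` is not a square modulo `𝔭` -/
  | A1B'
  /-- `⟨1, -δ, π ^ s⟩` to `⟨1, -δ, π ^ (s + 2)⟩`, for `s ≥ 1` -/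
  | A2A2 (s : ℕ)
  /-- `⟨1, -δ, π⟩` to `⟨1, π, δ π⟩`, if `-1` is a square modulo `𝔭` -/
  | A2B
  /-- `⟨1, -δ, π⟩` to `⟨1, π, π⟩`, if `-1` is not a square modulo `𝔭` -/
  | A2B'
  /-- `⟨1, π, π⟩` to `⟨1, π, π ^ 2⟩` -/
  | BC₁
  /-- `⟨1, π, π⟩` to `⟨1, δ π, π ^ 2⟩` -/
  | BC₂
  /-- `⟨1, π, δ π⟩` to `⟨1, π, δ π ^ 2⟩` -/
  | BC₃
  /-- `⟨1, π, δ π⟩` to `⟨1, δ π, δ π ^ 2⟩` -/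
  | BC₄
  /-- `⟨1, π, π ^ s⟩` to `⟨1, π, π ^ (s + 1)⟩`, for `s ≥ 2` -/
  | CC₁ (s : ℕ)
  /-- `⟨1, δ π, π ^ s⟩` to `⟨1, δ π, δ π ^ (s + 1)⟩`, for `s ≥ 2` -/
  | CC₂ (s : ℕ)
  /-- `⟨1, π, δ π ^ s⟩` to `⟨1, π, δ π ^ (s + 1)⟩`, for `s ≥ 2` -/
  | CC₃ (s : ℕ)
  /-- `⟨1, δ π, δ π ^ s⟩` to `⟨1, δ π, π ^ (s + 1)⟩`, for `s ≥ 2` -/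
  | CC₄ (s : ℕ)

/-- The conditions on `s` and on `-1` under which a row occurs. -/
def Row.Occurs (R : Type*) [CommRing R] [IsLocalRing R] : Row → Prop
  | A1B | A2B => IsSquare (-1 : ResidueField R)
  | A1B' | A2B' => ¬ IsSquare (-1 : ResidueField R)
  | A2A2 s => 1 ≤ s
  | CC₁ s | CC₂ s | CC₃ s | CC₄ s => 2 ≤ s
  | _ => True

/-- The pair `(a, b)` such that `f = ⟨1, a, b⟩` is the form of the given order. -/
def Row.top {R : Type*} [CommRing R] (P : Params R) : Row → R × R
  | A1A1 s => (-1, P.π ^ s)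
  | A1A2 => (-1, 1)
  | A1B | A1B' => (-1, P.π)
  | A2A2 s => (-P.δ, P.π ^ s)
  | A2B | A2B' => (-P.δ, P.π)
  | BC₁ | BC₂ => (P.π, P.π)
  | BC₃ | BC₄ => (P.π, P.δ * P.π)
  | CC₁ s => (P.π, P.π ^ s)
  | CC₂ s => (P.δ * P.π, P.π ^ s)
  | CC₃ s => (P.π, P.δ * P.π ^ s)
  | CC₄ s => (P.δ * P.π, P.δ * P.π ^ s)

/-- The elements `1, d₁, d₂, d₃` spanning the maximal suborder, in terms of a (quasi-)good basis
`e` of the given order. -/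
def Row.d {R : Type*} (K : Type*) {B : Type*} [CommRing R] [Field K] [Ring B]
    [Algebra R K] [Algebra R B] [Algebra K B] (P : Params R) (e : Fin 4 → B) : Row → Fin 4 → B
  | A1A1 _ => ![1, P.α₀ • e 1 + P.α₁ • e 2, P.α₁ • e 1 + P.α₀ • e 2, e 3]
  | A1A2 => ![1, P.π • (P.β₁ • e 1 - P.β₀ • e 3), P.π • e 2, P.β₀ • e 1 + P.β₁ • e 3]
  | A1B | A2B => ![1, (P.μ * P.π) • e 3, P.μ • e 1, e 2]
  | A1B' => ![1, (P.ν * P.π) • e 3, P.ν • e 1, e 2]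
  | A2A2 _ => ![1, P.π • e 1, P.π • e 2, e 3]
  | A2B' => ![1, (algebraMap R K P.ν)⁻¹ • P.π • e 3, (algebraMap R K P.ν)⁻¹ • e 1, e 2]
  | BC₁ | BC₃ | CC₁ _ | CC₃ _ => ![1, P.π • e 2, e 1, e 3]
  | BC₂ => ![1, P.π • (-(P.β₁ • e 2) + P.β₀ • e 3), e 1, P.β₀ • e 2 + P.β₁ • e 3]
  | BC₄ => ![1, (P.δ * P.π) • e 3, e 1, e 2]
  | CC₂ _ => ![1, (P.δ * P.π) • e 2, e 1, e 3]
  | CC₄ _ => ![1, (P.δ * P.π) • e 2, (algebraMap R K P.δ)⁻¹ • e 1, e 3]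

/-- The index of the unit groups, where `q` is the order of the residue field. -/
def Row.unitIndex (q : ℕ) : Row → ℕ
  | A1A1 0 => q + 1
  | A1A1 (_ + 1) => q
  | A1A2 => q * (q - 1)
  | A1B | A1B' => q - 1
  | A2A2 _ => q ^ 2
  | A2B | A2B' => q + 1
  | BC₁ | BC₂ | BC₃ | BC₄ | CC₁ _ | CC₂ _ | CC₃ _ | CC₄ _ => q

/-- The set of pairs over the residue field that parametrizes representatives in case A1 to A2. -/
def pairSet {R : Type*} [CommRing R] [IsLocalRing R] (P : Params R) :
    Set (ResidueField R × ResidueField R) :=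
  {t | 1 - residue R P.δ * t.1 ^ 2 + t.2 ^ 2 ≠ 0}

/-- The table of representatives. Here `q` is the order of the residue field, `a 1, …, a q`
represent the residue classes, and `γ` lifts pairs of residue classes. -/
def Row.reps {R : Type*} (K : Type*) {B : Type*} [CommRing R] [IsLocalRing R] [Field K] [Ring B]
    [Algebra R K] [Algebra R B] [Algebra K B] (P : Params R) (q : ℕ) (a : ℕ → R)
    (γ : ResidueField R × ResidueField R → R × R) (e : Fin 4 → B) : Row → Set B
  | A1A1 0 =>
      {e 1} ∪ {x | ∃ i ∈ Set.Icc 1 q, x = 1 + (algebraMap R K (a i) / 2) • (e 1 - P.ε • e 2)}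
  | A1A1 (_ + 1) =>
      {x | ∃ i ∈ Set.Icc 1 q, x = 1 + (algebraMap R K (a i) / 2) • (e 1 - P.ε • e 2)}
  | A1A2 =>
      {e 2} ∪ {x | ∃ t ∈ pairSet P,
        x = 1 + (γ t).1 • (P.β₁ • e 1 - P.β₀ • e 3) + (γ t).2 • e 2}
  | A1B | A1B' => {1} ∪ {x | ∃ i ∈ Set.Icc 3 q, x = algebraMap R B (a i) + e 3}
  | A2A2 _ =>
      {x | ∃ i ∈ Set.Icc 1 q, ∃ j ∈ Set.Icc 1 q, x = 1 + a i • e 1 + a j • e 2}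
  | A2B | A2B' => {1} ∪ {x | ∃ i ∈ Set.Icc 1 q, x = algebraMap R B (a i) + e 3}
  | BC₄ => {1} ∪ {x | ∃ i ∈ Set.Icc 1 (q - 1), x = algebraMap R B (a i) + e 3}
  | BC₁ | BC₂ | BC₃ | CC₁ _ | CC₂ _ | CC₃ _ | CC₄ _ =>
      {1} ∪ {x | ∃ i ∈ Set.Icc 1 (q - 1), x = algebraMap R B (a i) + e 2}

/-- The unit group of a suborder `O' ≤ O`, as a subgroup of the unit group of `O`. -/
def unitSubgroup {R B : Type*} [CommRing R] [Ring B] [Algebra R B] {O' O : Subalgebra R B}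
    (h : O' ≤ O) : Subgroup (↥O)ˣ :=
  (Units.map (Subalgebra.inclusion h : ↥O' →* ↥O)).range

/-- `T` consists of units of `O` and contains exactly one element of each coset `O'ˣ x`,
`x ∈ Oˣ`. -/
def IsRepSystem {R B : Type*} [CommRing R] [Ring B] [Algebra R B] {O' O : Subalgebra R B}
    (h : O' ≤ O) (T : Set B) : Prop :=
  ∃ S : Set (↥O)ˣ, (fun u : (↥O)ˣ => ((u : ↥O) : B)) '' S = T ∧
    Subgroup.IsComplement (unitSubgroup h : Set (↥O)ˣ) S

end BassOrder

/-! A good basis identifies `O` with the quaternion ring over `R` with `i = e₂`, `j = e₃`, `k =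
-e₁`, so `O / 𝔭O` is the quaternion ring over the residue field `k` with `i² = -b`, `j² = -a`
(possibly degenerate). A quasi-good basis has the same image in this quotient, which is why it
serves equally well.

Every suborder in the table contains `𝔭O`, so it is the preimage of a subalgebra `W` of `O / 𝔭O`,
given as the kernel of a linear map `f`. As `R` is local, an element of `O` is a unit exactly when
its reduction has nonzero norm. The cosets of the unit groups are therefore those of `W` modulo `𝔭`,
and since `t⁻¹` is a scalar multiple of the conjugate of `t`, the elements `u` and `t` lie in the
same coset if and only if `f (u * star t) = 0`. This is a linear condition over `k`, and
`exists_suborder` reduces each row to showing that it selects exactly one `t` for each `u` of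
nonzero norm.

If the condition reads `r A(u) = C(u)` for a parameter `r`, the cosets correspond to points `C(u) /
A(u)` of a projective line, one extra representative standing for infinity
(`exists_suborder_pencil`). The remaining rows are a split order without the point at infinity, and
the two where `W` is the quadratic extension of `k`. There the condition is a 2 × 2 system whose
determinant is, up to a nonzero factor, a value of the anisotropic form `x² - δy²`; the index in A1
to A2 comes from counting its values. -/

open IsLocalRing Quaternion

namespace BassOrder

/-! ### Norm, conjugation and units in quaternion rings -/

section QuaternionNorm

variable {F : Type*} [CommRing F] {c₁ c₃ : F}

/-- The reduced norm of a quaternion algebra over a commutative ring. -/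
def qnorm (x : ℍ[F,c₁,c₃]) : F :=
  x.re ^ 2 - c₁ * x.imI ^ 2 - c₃ * x.imJ ^ 2 + c₁ * c₃ * x.imK ^ 2

theorem qnorm_mul (x y : ℍ[F,c₁,c₃]) : qnorm (x * y) = qnorm x * qnorm y := by
  simp only [qnorm, QuaternionAlgebra.re_mul, QuaternionAlgebra.imI_mul,
    QuaternionAlgebra.imJ_mul, QuaternionAlgebra.imK_mul]
  ring

theorem qnorm_one : qnorm (1 : ℍ[F,c₁,c₃]) = 1 := by simp [qnorm]

theorem mul_star_eq_qnorm (x : ℍ[F,c₁,c₃]) : x * star x = algebraMap F _ (qnorm x) := by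
  ext <;> simp [qnorm, QuaternionAlgebra.algebraMap_eq] <;> ring

theorem star_mul_eq_qnorm (x : ℍ[F,c₁,c₃]) : star x * x = algebraMap F _ (qnorm x) := by
  ext <;> simp [qnorm, QuaternionAlgebra.algebraMap_eq] <;> ring

theorem isUnit_of_isUnit_qnorm {x : ℍ[F,c₁,c₃]} (h : IsUnit (qnorm x)) : IsUnit x := by
  obtain ⟨n, hn⟩ := h
  have hn' : qnorm x * ↑n⁻¹ = 1 := by rw [← hn, Units.mul_inv]
  have hn'' : (↑n⁻¹ : F) * qnorm x = 1 := by rw [← hn, Units.inv_mul]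
  refine ⟨⟨x, (↑n⁻¹ : F) • star x, ?_, ?_⟩, rfl⟩
  · rw [mul_smul_comm, mul_star_eq_qnorm, Algebra.smul_def, ← map_mul, hn'', map_one]
  · rw [smul_mul_assoc, star_mul_eq_qnorm, Algebra.smul_def, ← map_mul, hn'', map_one]

theorem isUnit_qnorm {x : ℍ[F,c₁,c₃]} (h : IsUnit x) : IsUnit (qnorm x) := by
  obtain ⟨u, rfl⟩ := h
  refine IsUnit.of_mul_eq_one (qnorm (↑u⁻¹ : ℍ[F,c₁,c₃])) ?_
  rw [← qnorm_mul, Units.mul_inv, qnorm_one]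

/-- Conjugation is trace minus identity, so every subalgebra is stable under it. Hence a subalgebra
over a field contains the inverse of each of its elements of nonzero norm. -/
theorem star_eq_algebraMap_sub (x : ℍ[F,c₁,c₃]) :
    star x = algebraMap F _ (2 * x.re) - x := by
  ext <;> simp [QuaternionAlgebra.algebraMap_eq]; ring

end QuaternionNorm

theorem IsUnitalBasis.mem_iff {R B : Type*} [CommRing R] [Ring B] [Algebra R B]
    {O : Subalgebra R B} {e : Fin 4 → B} (h : IsUnitalBasis O e)
    {x : B} : x ∈ O ↔ ∃ c : Fin 4 → R, ∑ i, c i • e i = x := by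
  rw [← Subalgebra.mem_toSubmodule, ← h.span_eq, Submodule.mem_span_range_iff_exists_fun]

/-! ### Reduction of an order modulo `𝔭` -/

section Reduction

variable {R B : Type*} [CommRing R] [IsLocalRing R] [Ring B] [Algebra R B]

/-- The residue class of the element with coordinates `c` in a good basis, where the even Clifford
algebra of `⟨1, a, b⟩` is identified with the quaternion algebra with `i = e₂`, `j = e₃` and
`k = -e₁`. -/
noncomputable def redCoord (α β : ResidueField R) (c : Fin 4 → R) : ℍ[ResidueField R,-β,-α] :=
  ⟨residue R (c 0), residue R (c 2), residue R (c 3), -residue R (c 1)⟩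

/-- The quaternion basis of an order given by a good basis. -/
def IsGoodBasis.quaternionBasis {O : Subalgebra R B} {a b : R} {e : Fin 4 → B}
    (h : IsGoodBasis O a b e) (hm : ∀ i, e i ∈ O) : QuaternionAlgebra.Basis O (-b) 0 (-a) where
  i := ⟨e 2, hm 2⟩
  j := ⟨e 3, hm 3⟩
  k := -⟨e 1, hm 1⟩
  i_mul_i := by
    ext; simpa [Algebra.algebraMap_eq_smul_one] using h.sq_two
  j_mul_j := by
    ext; simpa [Algebra.algebraMap_eq_smul_one] using h.sq_three
  i_mul_j := by
    ext; simpa using h.two_three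
  j_mul_i := by
    ext; simpa using h.three_two

theorem algebraMap_quaternion_residueField (c₁ c₃ : ResidueField R) (r : R) :
    algebraMap R ℍ[ResidueField R,c₁,c₃] r = ⟨residue R r, 0, 0, 0⟩ := by
  rw [IsScalarTower.algebraMap_apply R (ResidueField R), QuaternionAlgebra.algebraMap_eq,
    ResidueField.algebraMap_eq]

/-- Reduction of a quaternion algebra over a local ring to its residue field. -/
noncomputable def quaternionReduction (a b : R) :
    ℍ[R,-b,-a] →ₐ[R] ℍ[ResidueField R,-residue R b,-residue R a] :=
  QuaternionAlgebra.Basis.liftHom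
    { i := ⟨0, 1, 0, 0⟩
      j := ⟨0, 0, 1, 0⟩
      k := ⟨0, 0, 0, 1⟩
      i_mul_i := by ext <;> simp [Algebra.smul_def, algebraMap_quaternion_residueField]
      j_mul_j := by ext <;> simp [Algebra.smul_def, algebraMap_quaternion_residueField]
      i_mul_j := by ext <;> simp
      j_mul_i := by ext <;> simp }

theorem quaternionReduction_apply (a b : R) (x : ℍ[R,-b,-a]) :
    quaternionReduction a b x =
      ⟨residue R x.re, residue R x.imI, residue R x.imJ, residue R x.imK⟩ := by
  ext <;> simp [quaternionReduction, QuaternionAlgebra.Basis.lift,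
    algebraMap_quaternion_residueField, Algebra.smul_def]

theorem qnorm_quaternionReduction (a b : R) (x : ℍ[R,-b,-a]) :
    qnorm (quaternionReduction a b x) = residue R (qnorm x) := by
  simp [quaternionReduction_apply, qnorm]

/-- The reduction of an order with a quasi-good basis modulo the maximal ideal. -/
theorem IsQuasiGoodBasis.exists_reduction {O : Subalgebra R B} {a b : R} {e : Fin 4 → B}
    (he : IsQuasiGoodBasis O a b e) :
    ∃ ρ : O →ₐ[R] ℍ[ResidueField R,-residue R b,-residue R a],
      (∀ x, qnorm (ρ x) ≠ 0 → IsUnit x) ∧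
      ∀ (c : Fin 4 → R) (x : O), (x : B) = ∑ i, c i • e i →
        ρ x = redCoord (residue R a) (residue R b) c := by
  obtain ⟨hbe, e', he', hee⟩ := he
  have hb' := he'.basis
  have hm (i) : e' i ∈ O := by
    rw [← Subalgebra.mem_toSubmodule, ← hb'.span_eq]
    exact Submodule.subset_span ⟨i, rfl⟩
  let f := (he'.quaternionBasis hm).liftHom
  have hf (x : ℍ[R,-b,-a]) : (f x : B) = ∑ i, ![x.re, -x.imK, x.imI, x.imJ] i • e' i := by
    simp [f, QuaternionAlgebra.Basis.lift, IsGoodBasis.quaternionBasis, Fin.sum_univ_four,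
      hb'.zero_eq, Algebra.algebraMap_eq_smul_one]
    abel
  have hf_inj : Function.Injective f := by
    rw [injective_iff_map_eq_zero]
    intro x hx
    have h := Fintype.linearIndependent_iff.1 hb'.linearIndependent _
      ((hf x).symm.trans (by rw [hx]; rfl))
    ext
    · simpa using h 0
    · simpa using h 2
    · simpa using h 3
    · simpa using h 1
  have hf_surj : Function.Surjective f := by
    intro y
    obtain ⟨c, hc⟩ := hb'.mem_iff.1 y.2
    refine ⟨⟨c 0, c 2, c 3, -c 1⟩, Subtype.ext ?_⟩
    rw [hf, ← hc]
    simp [Fin.sum_univ_four]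
  let E := AlgEquiv.ofBijective f ⟨hf_inj, hf_surj⟩
  let ρ := (quaternionReduction a b).comp (E.symm : O →ₐ[R] ℍ[R,-b,-a])
  have hρ (x : ℍ[R,-b,-a]) : ρ (f x) = quaternionReduction a b x := by
    change quaternionReduction a b (E.symm (E x)) = _
    rw [E.symm_apply_apply]
  -- The reduction kills `𝔭O`, hence it cannot distinguish a quasi-good basis from the good basis it
  -- is congruent to.
  have hρ_max : ∀ y ∈ maximalIdeal R • Subalgebra.toSubmodule O, ∃ h : y ∈ O, ρ ⟨y, h⟩ = 0 := by
    intro y hy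
    refine Submodule.smul_induction_on hy ?_ ?_
    · intro r hr z hz
      refine ⟨O.smul_mem hz r, ?_⟩
      have h : ρ (r • ⟨z, hz⟩) = 0 := by
        rw [map_smul, ← algebraMap_smul (ResidueField R), ResidueField.algebraMap_eq,
          (residue_eq_zero_iff r).2 hr, zero_smul]
      exact h
    · rintro y z ⟨hy, hy0⟩ ⟨hz, hz0⟩
      refine ⟨add_mem hy hz, ?_⟩
      have h : ρ (⟨y, hy⟩ + ⟨z, hz⟩) = 0 := by rw [map_add, hy0, hz0, add_zero]
      exact h
  refine ⟨ρ, fun x hx => ?_, fun c x hx => ?_⟩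
  · obtain ⟨y, rfl⟩ := hf_surj x
    rw [hρ, qnorm_quaternionReduction, ne_eq, residue_eq_zero_iff, mem_maximalIdeal,
      mem_nonunits_iff, not_not] at hx
    exact (isUnit_of_isUnit_qnorm hx).map f
  · obtain ⟨h, h0⟩ := hρ_max (∑ i, c i • (e' i - e i))
      (Submodule.sum_mem _ fun i _ => Submodule.smul_mem _ _ (hee i))
    have hx' : x = f ⟨c 0, c 2, c 3, -c 1⟩ - ⟨_, h⟩ := by
      ext
      simp only [hx, AddSubgroupClass.coe_sub, hf, smul_sub, Finset.sum_sub_distrib]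
      simp [Fin.sum_univ_four]
    rw [hx', map_sub, h0, sub_zero, hρ, quaternionReduction_apply]
    simp [redCoord]

end Reduction

/-! ### Values of the anisotropic form `x² - δy²` over a finite field -/

section Counting

variable {k : Type*} [Field k]

theorem sq_sub_mul_sq_eq_zero {δ : k} (hδ : ¬ IsSquare δ) {x y : k} (h : x ^ 2 - δ * y ^ 2 = 0) :
    x = 0 ∧ y = 0 := by
  have hy : y = 0 := by
    by_contra hy
    refine hδ ⟨x / y, ?_⟩
    field_simp
    linear_combination -h
  refine ⟨?_, hy⟩
  simpa [hy] using h

theorem exists_sq_sub_mul_sq_eq [Finite k] (h2 : (2 : k) ≠ 0) {δ : k} (hδ : δ ≠ 0) (c : k) :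
    ∃ x y : k, x ^ 2 - δ * y ^ 2 = c := by
  have := Fintype.ofFinite k
  obtain ⟨x, y, h⟩ := FiniteField.exists_root_sum_quadratic
    (f := (Polynomial.X ^ 2 : Polynomial k))
    (g := Polynomial.C (-δ) * Polynomial.X ^ 2 + Polynomial.C 0 * Polynomial.X + Polynomial.C (-c))
    (by simp) (Polynomial.degree_quadratic (neg_ne_zero.2 hδ))
    (FiniteField.odd_card_of_char_ne_two fun h => h2 (by
      rw [← Nat.cast_ofNat, ← h, ringChar.Nat.cast_ringChar]))
  refine ⟨x, y, ?_⟩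
  simp at h
  linear_combination h

-- The form is the norm from `k(√δ)`. Multiplication by an element of norm `c` carries the fibre
-- over 1 to the fibre over `c`, so all nonzero fibres have the same size `N`. The fibre over 0 is a
-- point, and `q² = 1 + (q - 1) N` gives `N = q + 1`.
open Finset in
theorem card_sq_sub_mul_sq_eq [Fintype k] [DecidableEq k] (h2 : (2 : k) ≠ 0) {δ : k}
    (hδ : ¬ IsSquare δ) {c : k} (hc : c ≠ 0) :
    #{t : k × k | t.2 ^ 2 - δ * t.1 ^ 2 = c} = Fintype.card k + 1 := by
  have hδ0 : δ ≠ 0 := by rintro rfl; exact hδ (IsSquare.zero)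
  let F (c : k) : Finset (k × k) := {t : k × k | t.2 ^ 2 - δ * t.1 ^ 2 = c}
  have key {c : k} (hc : c ≠ 0) : #(F c) = #(F 1) := by
    obtain ⟨x, y, hxy⟩ := exists_sq_sub_mul_sq_eq h2 hδ0 c
    refine Finset.card_nbij' (fun t => ((x * t.1 - y * t.2) / c, (x * t.2 - δ * y * t.1) / c))
      (fun t => (x * t.1 + y * t.2, x * t.2 + δ * y * t.1)) ?_ ?_ ?_ ?_
    · intro t ht
      simp only [F, coe_filter, mem_univ, true_and, Set.mem_ofPred_eq] at ht ⊢
      field_simp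
      linear_combination (x ^ 2 - δ * y ^ 2) * ht + c * hxy
    · intro t ht
      simp only [F, coe_filter, mem_univ, true_and, Set.mem_ofPred_eq] at ht ⊢
      linear_combination (x ^ 2 - δ * y ^ 2) * ht + hxy
    · intro t _
      ext <;> field_simp
      · linear_combination t.1 * hxy
      · linear_combination t.2 * hxy
    · intro t _
      ext <;> field_simp
      · linear_combination t.1 * hxy
      · linear_combination t.2 * hxy
  have h0 : F 0 = {0} := by
    ext t
    simp only [F, mem_filter, mem_univ, true_and, mem_singleton]
    constructor
    · intro h
      obtain ⟨h1, h2⟩ := sq_sub_mul_sq_eq_zero hδ h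
      exact Prod.ext h2 h1
    · rintro rfl
      simp
  have hsum : Fintype.card k * Fintype.card k = ∑ c, #(F c) := by
    rw [← Fintype.card_prod, ← Finset.card_univ]
    exact Finset.card_eq_sum_card_fiberwise fun _ _ => mem_univ _
  rw [← Finset.add_sum_erase _ _ (mem_univ 0), h0, card_singleton,
    Finset.sum_congr rfl fun c hc => key (ne_of_mem_erase hc), sum_const,
    card_erase_of_mem (mem_univ 0), card_univ, smul_eq_mul] at hsum
  change #(F c) = _
  rw [key hc]
  obtain ⟨n, hn⟩ : ∃ n, Fintype.card k = n + 2 :=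
    ⟨Fintype.card k - 2, by have := Fintype.one_lt_card (α := k); omega⟩
  rw [hn] at hsum ⊢
  simp only [Nat.add_succ_sub_one] at hsum
  nlinarith

/-- The excluded pairs are the `q + 1` elements of norm `-1`. The additional 1 accounts for the
representative `e₂` in the row A1 to A2. -/
theorem card_pairs [Finite k] (h2 : (2 : k) ≠ 0) {δ : k} (hδ : ¬ IsSquare δ) :
    Nat.card {t : k × k | 1 - δ * t.1 ^ 2 + t.2 ^ 2 ≠ 0} + 1 = Nat.card k * (Nat.card k - 1) := by
  classical
  have := Fintype.ofFinite k
  have h := card_sq_sub_mul_sq_eq h2 hδ (c := -1) (by simp)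
  have h' := Finset.card_filter_add_card_filter_not (s := Finset.univ)
    (fun t : k × k => t.2 ^ 2 - δ * t.1 ^ 2 = -1)
  rw [h, Finset.card_univ, Fintype.card_prod] at h'
  have h'' : Nat.card {t : k × k | 1 - δ * t.1 ^ 2 + t.2 ^ 2 ≠ 0} =
      (Finset.univ.filter fun t : k × k => ¬ t.2 ^ 2 - δ * t.1 ^ 2 = -1).card := by
    rw [Nat.card_eq_card_toFinset]
    congr 1
    ext t
    simp only [Set.mem_toFinset, Set.mem_ofPred_eq, Finset.mem_filter, Finset.mem_univ, true_and]
    refine not_congr ⟨fun h => ?_, fun h => ?_⟩ <;> linear_combination h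
  rw [h'', Nat.card_eq_fintype_card, Nat.mul_sub_one]
  omega

end Counting

/-- Here `none` stands for the isolated representative (the point at infinity) and `some i` for the
members of the family. -/
theorem existsUnique_option {ι : Type*} {p : Option ι → Prop}
    (h : (p none ∧ ∀ i, ¬ p (some i)) ∨ (¬ p none ∧ ∃! i, p (some i))) : ∃! i, p i := by
  rcases h with ⟨h1, h2⟩ | ⟨h1, i, hi, hi'⟩
  · refine ⟨none, h1, ?_⟩
    rintro (_ | i) hi
    · rfl
    · exact absurd hi (h2 i)
  · refine ⟨some i, hi, ?_⟩
    rintro (_ | j) hj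
    · exact absurd hj h1
    · rw [hi' j hj]

theorem existsUnique_of_bijOn {X Y : Type*} {g : X → Y} {J : Set X} {S : Set Y}
    (h : Set.BijOn g J S) {s : Y} (hs : s ∈ S) : ∃! i : J, g i = s := by
  obtain ⟨i, hi, rfl⟩ := h.surjOn hs
  exact ⟨⟨i, hi⟩, rfl, fun j hj => Subtype.ext (h.injOn j.2 hi hj)⟩

theorem exists_mul_eq_one_of_residue_ne_zero {R : Type*} [CommRing R] [IsLocalRing R] {x : R}
    (h : residue R x ≠ 0) : ∃ y, y * x = 1 := by
  have : IsUnit x := by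
    rwa [ne_eq, residue_eq_zero_iff, mem_maximalIdeal, mem_nonunits_iff, not_not] at h
  obtain ⟨u, rfl⟩ := this
  exact ⟨_, u.inv_mul⟩

theorem inv_algebraMap_smul {R K B : Type*} [CommRing R] [Field K] [Ring B] [Algebra R K]
    [Algebra K B] [Algebra R B] [IsScalarTower R K B] {r s : R} (h : s * r = 1) (x : B) :
    (algebraMap R K r)⁻¹ • x = s • x := by
  rw [inv_eq_of_mul_eq_one_left (by rw [← map_mul, h, map_one]), algebraMap_smul]

/-- For `a = -1` and `b = 0` in `k`, the norm of `s + e₃` is `s² - 1`. Its roots `1` and `-1` are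
the residues with index 1 and 2, so the list of representatives starts at index 3. -/
theorem bijOn_residue_three {k : Type*} [Field k] {q : ℕ} {a : ℕ → k} (hq : 3 ≤ q)
    (ha : Set.BijOn a (Set.Icc 1 q) Set.univ) (ha_one : a 1 = 1) (ha_two : a 2 = -1) :
    Set.BijOn a (Set.Icc 3 q) {s | s ^ 2 + -1 ≠ 0} := by
  convert! ha.subset_right (Set.subset_univ _) using 1
  ext i
  simp only [Set.mem_Icc, Set.mem_inter_iff, Set.mem_preimage, Set.mem_ofPred_eq]
  constructor
  · rintro ⟨h3, hi⟩
    refine ⟨⟨by omega, hi⟩, fun h => ?_⟩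
    have h' : (a i - 1) * (a i + 1) = 0 := by linear_combination h
    rcases mul_eq_zero.1 h' with h | h
    · have := ha.injOn (x₁ := i) (x₂ := 1) ⟨by omega, hi⟩ ⟨le_rfl, by omega⟩
        (by rw [ha_one]; linear_combination h)
      omega
    · have := ha.injOn (x₁ := i) (x₂ := 2) ⟨by omega, hi⟩ ⟨by omega, by omega⟩
        (by rw [ha_two]; linear_combination h)
      omega
  · rintro ⟨⟨h1, hi⟩, h⟩
    refine ⟨?_, hi⟩
    by_contra h3
    obtain rfl | rfl : i = 1 ∨ i = 2 := by omega
    · simp [ha_one] at h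
    · simp [ha_two] at h

theorem bijOn_residue_ne_zero {k : Type*} [Field k] {q : ℕ} {a : ℕ → k} (hq : 1 ≤ q)
    (ha : Set.BijOn a (Set.Icc 1 q) Set.univ) (ha_last : a q = 0) :
    Set.BijOn a (Set.Icc 1 (q - 1)) {s | s ≠ 0} := by
  convert! ha.subset_right (Set.subset_univ _) using 1
  ext i
  simp only [Set.mem_Icc, Set.mem_inter_iff, Set.mem_preimage, Set.mem_ofPred_eq]
  constructor
  · rintro ⟨h1, hi⟩
    refine ⟨⟨h1, by omega⟩, fun h => ?_⟩
    have := ha.injOn (x₁ := i) (x₂ := q) ⟨h1, by omega⟩ ⟨hq, le_rfl⟩ (by rw [h, ha_last])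
    omega
  · rintro ⟨⟨h1, hi⟩, h⟩
    refine ⟨h1, ?_⟩
    have : i ≠ q := by rintro rfl; exact h ha_last
    omega

/-! ### Suborders as preimages of subalgebras modulo `𝔭` -/

section Suborders

variable {R B : Type*} [CommRing R] [IsLocalRing R] [Ring B] [Algebra R B]

/-- The order that reduces to the kernel of `f` has the unit index and the representatives that
are found modulo the maximal ideal. -/
theorem exists_suborder {O : Subalgebra R B} {a b : R} {e : Fin 4 → B}
    (he : IsQuasiGoodBasis O a b e) {α β : ResidueField R} (hα : residue R a = α)
    (hβ : residue R b = β) {M : Type*} [AddCommGroup M] [Module (ResidueField R) M]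
    (f : ℍ[ResidueField R,-β,-α] →ₗ[ResidueField R] M) (f_one : f 1 = 0)
    (f_mul : ∀ x y, f x = 0 → f y = 0 → f (x * y) = 0)
    {d : Fin 4 → B} (D : Fin 4 → Fin 4 → R) (hd : ∀ i, d i = ∑ j, D i j • e j)
    (hD : ∀ i, f (redCoord α β (D i)) = 0)
    (hspan : ∀ c, f (redCoord α β c) = 0 → ∃ m : Fin 4 → R, ∀ j, c j = ∑ i, m i * D i j)
    {ι : Type*} (t : ι → Fin 4 → R) (ht : ∀ i, qnorm (redCoord α β (t i)) ≠ 0)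
    (hu : ∀ u, qnorm u ≠ 0 → ∃! i, f (u * star (redCoord α β (t i))) = 0)
    {T : Set B} (hT : T = Set.range fun i => ∑ j, t i j • e j) {n : ℕ} (hn : Nat.card ι = n) :
    ∃ (O' : Subalgebra R B) (h : O' ≤ O),
      Subalgebra.toSubmodule O' = Submodule.span R (Set.range d) ∧
      (unitSubgroup h).index = n ∧ IsRepSystem h T := by
  subst hα hβ hT hn
  obtain ⟨ρ, hloc, hρ⟩ := he.exists_reduction
  have hbe := he.1
  have hmem (c : Fin 4 → R) : ∑ j, c j • e j ∈ O := hbe.mem_iff.2 ⟨c, rfl⟩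
  have hρ' (c : Fin 4 → R) : ρ ⟨_, hmem c⟩ = redCoord _ _ c := hρ c _ rfl
  have f_algebraMap (r : ResidueField R) : f (algebraMap _ _ r) = 0 := by
    rw [Algebra.algebraMap_eq_smul_one, map_smul, f_one, smul_zero]
  let W : Subalgebra R ℍ[ResidueField R,-residue R b,-residue R a] :=
    { carrier := {x | f x = 0}
      mul_mem' := fun hx hy => f_mul _ _ hx hy
      add_mem' := fun {x y} hx hy => by
        simp only [Set.mem_ofPred_eq] at hx hy ⊢; rw [map_add, hx, hy, add_zero]
      algebraMap_mem' := fun r => by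
        rw [Set.mem_ofPred_eq, IsScalarTower.algebraMap_apply R (ResidueField R)]
        exact f_algebraMap _ }
  let O' : Subalgebra R B := (W.comap ρ).map O.val
  have hO' (x : O) : (x : B) ∈ O' ↔ f (ρ x) = 0 := by
    constructor
    · rintro ⟨y, hy, hyx⟩
      rw [← Subtype.ext hyx]
      exact hy
    · exact fun hx => ⟨x, hx, rfl⟩
  have h : O' ≤ O := by
    rintro _ ⟨y, -, rfl⟩
    exact y.2
  have hsub (u : (↥O)ˣ) : u ∈ unitSubgroup h ↔ f (ρ u) = 0 := by
    constructor
    · rintro ⟨v, rfl⟩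
      exact (hO' _).1 (v : ↥O').2
    · intro hfu
      -- The inverse is the conjugate divided by the norm, and the conjugate is a scalar minus the
      -- element, so `f` vanishes on it as well.
      have hinv : f (ρ ↑u⁻¹) = 0 := by
        have h1 : ρ ↑u⁻¹ * ρ u = 1 := by rw [← map_mul, Units.inv_mul, map_one]
        have h2 : qnorm (ρ u) ≠ 0 := fun h0 => by
          have := congrArg qnorm h1
          rw [qnorm_mul, h0, mul_zero, qnorm_one] at this
          exact zero_ne_one this
        have h3 : qnorm (ρ u) • ρ ↑u⁻¹ = star (ρ u) := by
          rw [← mul_one (ρ ↑u⁻¹), ← mul_smul_comm, ← Algebra.algebraMap_eq_smul_one,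
            ← mul_star_eq_qnorm, ← mul_assoc, h1, one_mul]
        have h4 : qnorm (ρ u) • f (ρ ↑u⁻¹) = 0 := by
          rw [← map_smul, h3, star_eq_algebraMap_sub, map_sub, f_algebraMap, hfu, sub_zero]
        exact (smul_eq_zero.1 h4).resolve_left h2
      refine ⟨⟨⟨_, (hO' _).2 hfu⟩, ⟨_, (hO' _).2 hinv⟩, ?_, ?_⟩, ?_⟩
      · ext; simp [← Subalgebra.coe_mul]
      · ext; simp [← Subalgebra.coe_mul]
      · ext; rfl
  have htu (i : ι) : IsUnit (⟨_, hmem (t i)⟩ : O) := hloc _ (by rw [hρ']; exact ht i)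
  let τ : ι → (↥O)ˣ := fun i => (htu i).unit
  have hτ (i : ι) : ρ (τ i) = redCoord _ _ (t i) := hρ' _
  have hcoset (u : (↥O)ˣ) (i : ι) :
      u * (τ i)⁻¹ ∈ unitSubgroup h ↔ f (ρ u * star (redCoord _ _ (t i))) = 0 := by
    rw [hsub, ← hτ]
    have h1 : ρ ↑(τ i)⁻¹ * ρ (τ i) = 1 := by rw [← map_mul, Units.inv_mul, map_one]
    have h2 : qnorm (ρ (τ i)) ≠ 0 := by rw [hτ]; exact ht i
    have h3 : qnorm (ρ (τ i)) • ρ ↑(τ i)⁻¹ = star (ρ (τ i)) := by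
      rw [← mul_one (ρ ↑(τ i)⁻¹), ← mul_smul_comm, ← Algebra.algebraMap_eq_smul_one,
        ← mul_star_eq_qnorm, ← mul_assoc, h1, one_mul]
    rw [← h3, mul_smul_comm, map_smul, smul_eq_zero, or_iff_right h2, Units.val_mul, map_mul]
  have hunit (u : (↥O)ˣ) : qnorm (ρ u) ≠ 0 := (isUnit_qnorm (u.isUnit.map ρ)).ne_zero
  have hex (u : (↥O)ˣ) : ∃! i, u * (τ i)⁻¹ ∈ unitSubgroup h := by
    simp only [hcoset]
    exact hu _ (hunit u)
  have hinj : Function.Injective τ := fun i j hij =>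
    (hex (τ i)).unique (by rw [mul_inv_cancel]; exact one_mem _)
      (by rw [hij, mul_inv_cancel]; exact one_mem _)
  have hcompl : Subgroup.IsComplement (unitSubgroup h : Set (↥O)ˣ) (Set.range τ) := by
    rw [Subgroup.isComplement_iff_existsUnique_mul_inv_mem]
    intro g
    obtain ⟨i, hi, hi'⟩ := hex g
    refine ⟨⟨_, i, rfl⟩, hi, ?_⟩
    rintro ⟨_, j, rfl⟩ hj
    exact Subtype.ext (congrArg τ (hi' j hj))
  refine ⟨O', h, ?_, ?_, Set.range τ, ?_, hcompl⟩
  · have hdmem (i : Fin 4) : d i ∈ O' := by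
      rw [hd]
      exact (hO' ⟨_, hmem _⟩).2 (by rw [hρ']; exact hD i)
    apply le_antisymm
    · intro x hx
      obtain ⟨c, rfl⟩ := hbe.mem_iff.1 (h hx)
      have hc := (hO' ⟨_, hmem c⟩).1 hx
      rw [hρ'] at hc
      obtain ⟨m, hm⟩ := hspan c hc
      rw [Submodule.mem_span_range_iff_exists_fun]
      refine ⟨m, ?_⟩
      simp only [hd, hm, Finset.smul_sum, Finset.sum_smul, smul_smul]
      exact Finset.sum_comm
    · rw [Submodule.span_le]
      rintro _ ⟨i, rfl⟩
      exact hdmem i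
  · rw [← hcompl.card_right, Nat.card_range_of_injective hinj]
  · rw [← Set.range_comp]
    rfl

/-- The case of `exists_suborder` where the representatives are one element and a subset of a
one-parameter family. -/
theorem exists_suborder_pencil {O : Subalgebra R B} {a b : R} {e : Fin 4 → B}
    (he : IsQuasiGoodBasis O a b e) {α β : ResidueField R} (hα : residue R a = α)
    (hβ : residue R b = β) {M : Type*} [AddCommGroup M] [Module (ResidueField R) M]
    (f : ℍ[ResidueField R,-β,-α] →ₗ[ResidueField R] M) (f_one : f 1 = 0)
    (f_mul : ∀ x y, f x = 0 → f y = 0 → f (x * y) = 0)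
    {d : Fin 4 → B} (D : Fin 4 → Fin 4 → R) (hd : ∀ i, d i = ∑ j, D i j • e j)
    (hD : ∀ i, f (redCoord α β (D i)) = 0)
    (hspan : ∀ c, f (redCoord α β c) = 0 → ∃ m : Fin 4 → R, ∀ j, c j = ∑ i, m i * D i j)
    (z : Fin 4 → R) (x : R → Fin 4 → R) {S : Set (ResidueField R)} {J : Set ℕ} {r : ℕ → R}
    (hJ : Set.BijOn (fun i => residue R (r i)) J S)
    (hz : qnorm (redCoord α β z) ≠ 0)
    (hx : ∀ r, residue R r ∈ S → qnorm (redCoord α β (x r)) ≠ 0)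
    (A C : ℍ[ResidueField R,-β,-α] → ResidueField R)
    (hA : ∀ u, f (u * star (redCoord α β z)) = 0 ↔ A u = 0)
    (hC : ∀ u r, f (u * star (redCoord α β (x r))) = 0 ↔ residue R r * A u = C u)
    (h_zero : ∀ u, qnorm u ≠ 0 → A u = 0 → C u ≠ 0)
    (h_mem : ∀ u, qnorm u ≠ 0 → A u ≠ 0 → C u / A u ∈ S)
    {T : Set B} (hT : T = {∑ j, z j • e j} ∪ {y | ∃ i ∈ J, y = ∑ j, x (r i) j • e j})
    {n : ℕ} (hJ_fin : J.Finite) (hn : Nat.card J + 1 = n) :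
    ∃ (O' : Subalgebra R B) (h : O' ≤ O),
      Subalgebra.toSubmodule O' = Submodule.span R (Set.range d) ∧
      (unitSubgroup h).index = n ∧ IsRepSystem h T := by
  have := hJ_fin.to_subtype
  refine exists_suborder he hα hβ f f_one f_mul D hd hD hspan
    (ι := Option J) (fun i => i.elim z fun i => x (r i)) ?_ ?_ ?_ ?_
  · rintro (_ | i)
    · exact hz
    · exact hx _ (hJ.mapsTo i.2)
  · intro u hu
    apply existsUnique_option
    -- If `A u = 0`, only `z` represents the coset; otherwise the parameter must be `C u / A u`.
    simp only [Option.elim, hA, hC]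
    by_cases h : A u = 0
    · refine Or.inl ⟨h, fun i hi => h_zero u hu h ?_⟩
      rw [← hi, h, mul_zero]
    · refine Or.inr ⟨h, ?_⟩
      simp only [← eq_div_iff h]
      exact existsUnique_of_bijOn hJ (h_mem u hu h)
  · rw [hT]
    ext y
    simp [Option.exists, eq_comm]
  · rw [Finite.card_option, hn]

/-- Suborders whose reduction is spanned by `1, e₁, e₂`, in an order with `b` in the maximal
ideal. -/
theorem exists_suborder_span_one_two {O : Subalgebra R B} {a b : R} {e : Fin 4 → B}
    (he : IsQuasiGoodBasis O a b e) {α : ResidueField R} (hα : residue R a = α)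
    (hb : residue R b = 0) {p v w v' w' : R} (hp : ∀ x, residue R x = 0 → ∃ y, x = p * y)
    (hp' : residue R p = 0) (hv : v' * v = 1) (hw : w' * w = 1)
    {d : Fin 4 → B} (hd : d = ![1, (v * p) • e 3, w • e 1, e 2])
    {J : Set ℕ} {r : ℕ → R}
    (hJ : Set.BijOn (fun i => residue R (r i)) J {s | s ^ 2 + α ≠ 0})
    {T : Set B} (hT : T = {1} ∪ {y | ∃ i ∈ J, y = algebraMap R B (r i) + e 3})
    {n : ℕ} (hJ_fin : J.Finite) (hn : Nat.card J + 1 = n) :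
    ∃ (O' : Subalgebra R B) (h : O' ≤ O),
      Subalgebra.toSubmodule O' = Submodule.span R (Set.range d) ∧
      (unitSubgroup h).index = n ∧ IsRepSystem h T := by
  refine exists_suborder_pencil he hα hb (QuaternionAlgebra.imJₗ _ _ _) (by simp) ?_
    ![![1, 0, 0, 0], ![0, 0, 0, v * p], ![0, w, 0, 0], ![0, 0, 1, 0]] ?_ ?_ ?_
    ![1, 0, 0, 0] (fun r => ![r, 0, 0, 1]) hJ ?_ ?_ (fun u => u.imJ) (fun u => u.re)
    ?_ ?_ ?_ ?_ ?_ hJ_fin hn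
  · intro x y hx hy
    simp only [QuaternionAlgebra.imJₗ_apply] at hx hy
    simp [hx, hy]
  · intro i
    fin_cases i <;> simp [hd, Fin.sum_univ_four, he.1.zero_eq]
  · intro i
    fin_cases i <;> simp [redCoord, hp']
  · intro c hc
    obtain ⟨y, hy⟩ := hp (c 3) (by simpa [redCoord] using hc)
    refine ⟨![c 0, v' * y, w' * c 1, c 2], fun j => ?_⟩
    fin_cases j <;> simp [Fin.sum_univ_four]
    · linear_combination -c 1 * hw
    · linear_combination hy - p * y * hv
  · simp [redCoord, qnorm]
  · intro r hr
    simpa [redCoord, qnorm] using hr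
  · intro u
    simp [redCoord]
  · intro u r
    simp [redCoord]
    constructor <;> intro h <;> linear_combination h
  -- With `b = 0` in `k` the norm is `re² + α imJ²`. As it is nonzero at `u`, the two coordinates do
  -- not both vanish, and `re / imJ` is not a root of `s² + α`.
  · intro u hu h1 h2
    apply hu
    simp [qnorm, h1, h2]
  · intro u hu h1 h2
    apply hu
    have : u.re ^ 2 + α * u.imJ ^ 2 = 0 := by
      field_simp at h2
      linear_combination h2
    simp [qnorm]
    linear_combination this
  · simp [hT, Fin.sum_univ_four, he.1.zero_eq, Algebra.algebraMap_eq_smul_one]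

/-- Suborders whose reduction is the kernel of `l₂ x₂ - l₃ x₃`, in an order with `a` and `b` in the
maximal ideal. -/
theorem exists_suborder_ker_of_nilpotent {O : Subalgebra R B} {a b : R} {e : Fin 4 → B}
    (he : IsQuasiGoodBasis O a b e) (ha : residue R a = 0) (hb : residue R b = 0)
    {l₂ l₃ : R} (hl : residue R l₂ ≠ 0)
    {d : Fin 4 → B} (D : Fin 4 → Fin 4 → R) (hd : ∀ i, d i = ∑ j, D i j • e j)
    (hD : ∀ i, residue R (l₂ * D i 2 - l₃ * D i 3) = 0)
    (hspan : ∀ c : Fin 4 → R, residue R (l₂ * c 2 - l₃ * c 3) = 0 →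
      ∃ m : Fin 4 → R, ∀ j, c j = ∑ i, m i * D i j)
    {J : Set ℕ} {r : ℕ → R} (hJ : Set.BijOn (fun i => residue R (r i)) J {s | s ≠ 0})
    {T : Set B} (hT : T = {1} ∪ {y | ∃ i ∈ J, y = algebraMap R B (r i) + e 2})
    {n : ℕ} (hJ_fin : J.Finite) (hn : Nat.card J + 1 = n) :
    ∃ (O' : Subalgebra R B) (h : O' ≤ O),
      Subalgebra.toSubmodule O' = Submodule.span R (Set.range d) ∧
      (unitSubgroup h).index = n ∧ IsRepSystem h T := by
  refine exists_suborder_pencil he ha hb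
    (residue R l₂ • QuaternionAlgebra.imIₗ _ _ _ - residue R l₃ • QuaternionAlgebra.imJₗ _ _ _)
    (by simp) ?_ D hd ?_ ?_
    ![1, 0, 0, 0] (fun r => ![r, 0, 1, 0]) hJ ?_ ?_
    (fun u => residue R l₂ * u.imI - residue R l₃ * u.imJ) (fun u => residue R l₂ * u.re)
    ?_ ?_ ?_ ?_ ?_ hJ_fin hn
  -- With `a = b = 0` in `k`, the `i` and `j` coordinates of a product obey the Leibniz rule with
  -- weights `re`, so any linear combination of them has a multiplicatively closed kernel.
  · intro x y hx hy
    simp at hx hy ⊢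
    linear_combination x.re * hy + y.re * hx
  · intro i
    simpa [redCoord] using hD i
  · intro c hc
    exact hspan c (by simpa [redCoord] using hc)
  · simp [redCoord, qnorm]
  · intro r hr
    simpa [redCoord, qnorm] using hr
  · intro u
    simp [redCoord]
  · intro u r
    simp [redCoord]
    constructor <;> intro h <;> linear_combination h
  · intro u hu h1 h2
    apply hu
    simpa [qnorm, hl] using h2
  · intro u hu h1
    have : u.re ≠ 0 := fun h => hu (by simp [qnorm, h])
    exact div_ne_zero (mul_ne_zero hl this) h1
  · simp [hT, Fin.sum_univ_four, he.1.zero_eq, Algebra.algebraMap_eq_smul_one]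

/-- Suborders whose reduction is spanned by `1, e₁, e₃`, in an order with `a` and `b` in the maximal
ideal. -/
theorem exists_suborder_span_one_three_of_nilpotent {O : Subalgebra R B} {a b : R} {e : Fin 4 → B}
    (he : IsQuasiGoodBasis O a b e) (ha : residue R a = 0) (hb : residue R b = 0)
    {p v w v' w' : R} (hp : ∀ x, residue R x = 0 → ∃ y, x = p * y)
    (hp' : residue R p = 0) (hv : v' * v = 1) (hw : w' * w = 1)
    {d : Fin 4 → B} (hd : d = ![1, (v * p) • e 2, w • e 1, e 3])
    {J : Set ℕ} {r : ℕ → R} (hJ : Set.BijOn (fun i => residue R (r i)) J {s | s ≠ 0})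
    {T : Set B} (hT : T = {1} ∪ {y | ∃ i ∈ J, y = algebraMap R B (r i) + e 2})
    {n : ℕ} (hJ_fin : J.Finite) (hn : Nat.card J + 1 = n) :
    ∃ (O' : Subalgebra R B) (h : O' ≤ O),
      Subalgebra.toSubmodule O' = Submodule.span R (Set.range d) ∧
      (unitSubgroup h).index = n ∧ IsRepSystem h T := by
  refine exists_suborder_ker_of_nilpotent he ha hb (l₂ := 1) (l₃ := 0) (by simp)
    ![![1, 0, 0, 0], ![0, 0, v * p, 0], ![0, w, 0, 0], ![0, 0, 0, 1]] ?_ ?_ ?_ hJ hT hJ_fin hn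
  · intro i
    fin_cases i <;> simp [hd, Fin.sum_univ_four, he.1.zero_eq]
  · intro i
    fin_cases i <;> simp [hp']
  · intro c hc
    obtain ⟨y, hy⟩ := hp (c 2) (by simpa using hc)
    refine ⟨![c 0, v' * y, w' * c 1, c 3], fun j => ?_⟩
    fin_cases j <;> simp [Fin.sum_univ_four]
    · linear_combination -c 1 * hw
    · linear_combination hy - p * y * hv

/-- The suborder of an order with `a` and `b` in the maximal ideal whose reduction is spanned by `1`, `e₁` and
`β₀ e₂ + β₁ e₃`. -/
theorem exists_suborder_rotated_of_nilpotent {O : Subalgebra R B} {a b : R} {e : Fin 4 → B}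
    (he : IsQuasiGoodBasis O a b e) (ha : residue R a = 0) (hb : residue R b = 0)
    {p δ δ' β₀ β₁ : R} (hp : ∀ x, residue R x = 0 → ∃ y, x = p * y)
    (hp' : residue R p = 0) (hβ : β₀ ^ 2 + β₁ ^ 2 = δ) (hδ : δ' * δ = 1)
    (hβ₁ : residue R β₁ ≠ 0) {d : Fin 4 → B}
    (hd : d = ![1, p • (-(β₁ • e 2) + β₀ • e 3), e 1, β₀ • e 2 + β₁ • e 3])
    {J : Set ℕ} {r : ℕ → R} (hJ : Set.BijOn (fun i => residue R (r i)) J {s | s ≠ 0})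
    {T : Set B} (hT : T = {1} ∪ {y | ∃ i ∈ J, y = algebraMap R B (r i) + e 2})
    {n : ℕ} (hJ_fin : J.Finite) (hn : Nat.card J + 1 = n) :
    ∃ (O' : Subalgebra R B) (h : O' ≤ O),
      Subalgebra.toSubmodule O' = Submodule.span R (Set.range d) ∧
      (unitSubgroup h).index = n ∧ IsRepSystem h T := by
  refine exists_suborder_ker_of_nilpotent he ha hb (l₂ := β₁) (l₃ := β₀) hβ₁
    ![![1, 0, 0, 0], ![0, 0, -(p * β₁), p * β₀], ![0, 1, 0, 0], ![0, 0, β₀, β₁]]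
    ?_ ?_ ?_ hJ hT hJ_fin hn
  · intro i
    fin_cases i <;> simp [hd, Fin.sum_univ_four, he.1.zero_eq]
    module
  · intro i
    fin_cases i <;> simp [hp']
    ring
  · intro c hc
    obtain ⟨y, hy⟩ := hp _ hc
    -- Coordinates with respect to the orthogonal vectors `(-β₁, β₀)` and `(β₀, β₁)`, both of square
    -- length `δ`, a unit.
    refine ⟨![c 0, -(δ' * y), c 1, δ' * (β₀ * c 2 + β₁ * c 3)], fun j => ?_⟩
    fin_cases j <;> simp [Fin.sum_univ_four]
    · linear_combination (-c 2) * hδ - δ' * c 2 * hβ + δ' * β₁ * hy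
    · linear_combination (-c 3) * hδ - δ' * c 3 * hβ - δ' * β₀ * hy

/-- The condition describes the span of `1`, `j` and `n = i(1 - εj)`, where `j² = 1`, `jn = εn =
-nj` and `n² = 0`. These are the upper triangular elements for the idempotents `(1 ± εj)/2` when 2
is invertible. -/
theorem upperTriangular_mul {k : Type*} [Field k] {β ε : k} (hε : ε ^ 2 = 1)
    (x y : ℍ[k,-β,-(-1)]) (hx : x.imK + ε * x.imI = 0) (hy : y.imK + ε * y.imI = 0) :
    (x * y).imK + ε * (x * y).imI = 0 := by
  simp only [QuaternionAlgebra.imI_mul, QuaternionAlgebra.imK_mul]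
  linear_combination (x.re - ε * x.imJ) * hy + (y.re + ε * y.imJ) * hx +
    (x.imJ * y.imI - x.imI * y.imJ) * hε

/-- Cramer's rule for a matrix of determinant `α₀² - α₁² = p`. The numerators are divisible by `p`
because `α₀ ≡ εα₁` and `c₁ ≡ εc₂`. -/
theorem exists_coeff_upperTriangular {p α₀ α₁ ε : R} (hp0 : IsLeftRegular p)
    (hp : ∀ x, residue R x = 0 → ∃ y, x = p * y)
    (hα : α₀ ^ 2 - α₁ ^ 2 = p) (hε : ε ^ 2 = 1) (hs : residue R (α₀ - ε * α₁) = 0)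
    (c : Fin 4 → R) (hc : residue R (c 1 - ε * c 2) = 0) :
    ∃ m : Fin 4 → R, ∀ j, c j =
      ∑ i, m i * (![![1, 0, 0, 0], ![0, α₀, α₁, 0], ![0, α₁, α₀, 0], ![0, 0, 0, 1]] :
        Fin 4 → Fin 4 → R) i j := by
  obtain ⟨y, hy⟩ := hp (α₀ * c 1 - α₁ * c 2) (by
    have : α₀ * c 1 - α₁ * c 2 = (α₀ - ε * α₁) * c 1 + ε * α₁ * (c 1 - ε * c 2) := by
      linear_combination α₁ * c 2 * hε
    rw [this]; simp only [map_add, map_mul, hs, hc]; ring)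
  obtain ⟨z, hz⟩ := hp (α₀ * c 2 - α₁ * c 1) (by
    have : α₀ * c 2 - α₁ * c 1 = (α₀ - ε * α₁) * c 2 - α₁ * (c 1 - ε * c 2) := by ring
    rw [this]; simp only [map_sub, map_mul] at *; simp only [hs, hc]; ring)
  refine ⟨![c 0, y, z, c 3], fun j => ?_⟩
  fin_cases j <;> simp [Fin.sum_univ_four]
  · apply hp0
    change p * _ = p * _
    linear_combination α₀ * hy + α₁ * hz - c 1 * hα
  · apply hp0
    change p * _ = p * _
    linear_combination α₁ * hy + α₀ * hz - c 2 * hα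

/-- The suborders of index `p` in the maximal order of the matrix algebra. -/
theorem exists_suborder_of_matrix {O : Subalgebra R B} {a b : R} {e : Fin 4 → B}
    (he : IsQuasiGoodBasis O a b e) (ha : residue R a = -1) (hb : residue R b = 1)
    {p α₀ α₁ ε h₂ : R} (hp0 : IsLeftRegular p)
    (hp : ∀ x, residue R x = 0 → ∃ y, x = p * y)
    (hα : α₀ ^ 2 - α₁ ^ 2 = p) (hε : ε ^ 2 = 1) (hs : residue R (α₀ - ε * α₁) = 0)
    (h2 : h₂ * 2 = 1) {d : Fin 4 → B}
    (hd : d = ![1, α₀ • e 1 + α₁ • e 2, α₁ • e 1 + α₀ • e 2, e 3])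
    {J : Set ℕ} {r : ℕ → R} (hJ : Set.BijOn (fun i => residue R (r i)) J Set.univ)
    {T : Set B} (hT : T = {e 1} ∪ {y | ∃ i ∈ J, y = 1 + (r i * h₂) • (e 1 - ε • e 2)})
    {n : ℕ} (hJ_fin : J.Finite) (hn : Nat.card J + 1 = n) :
    ∃ (O' : Subalgebra R B) (h : O' ≤ O),
      Subalgebra.toSubmodule O' = Submodule.span R (Set.range d) ∧
      (unitSubgroup h).index = n ∧ IsRepSystem h T := by
  have hε' : residue R ε ^ 2 = 1 := by rw [← map_pow, hε, map_one]
  have h2' : residue R h₂ * 2 = 1 := by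
    rw [← map_ofNat (residue R) 2, ← map_mul, h2, map_one]
  -- In terms of 2 × 2 matrices, `f` is the lower left entry up to sign and `u.re - ε u.imJ` the
  -- lower right one. A coset of the upper triangular group is determined by the bottom row up to
  -- scaling, a point of the projective line; the norm is the determinant, so that row is nonzero.
  refine exists_suborder_pencil he ha hb
    (QuaternionAlgebra.imKₗ _ _ _ + residue R ε • QuaternionAlgebra.imIₗ _ _ _) (by simp) ?_
    ![![1, 0, 0, 0], ![0, α₀, α₁, 0], ![0, α₁, α₀, 0], ![0, 0, 0, 1]] ?_ ?_ ?_
    ![0, 1, 0, 0] (fun r => ![1, r * h₂, -(r * h₂ * ε), 0]) hJ ?_ ?_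
    (fun u => u.re - residue R ε * u.imJ) (fun u => -(u.imK + residue R ε * u.imI))
    ?_ ?_ ?_ ?_ ?_ hJ_fin hn
  · intro x y hx hy
    exact upperTriangular_mul hε' x y hx hy
  · intro i
    fin_cases i <;> simp [hd, Fin.sum_univ_four, he.1.zero_eq]
  · simp only [map_sub, map_mul] at hs
    intro i
    fin_cases i <;> simp [redCoord]
    · linear_combination -hs
    · linear_combination residue R ε * hs + residue R α₁ * hε'
  · intro c hc
    refine exists_coeff_upperTriangular hp0 hp hα hε hs c ?_
    simp [redCoord] at hc
    simp only [map_sub, map_mul]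
    linear_combination -hc
  · simp [redCoord, qnorm]
  · intro r _
    have : qnorm (redCoord (-1) 1 ![1, r * h₂, -(r * h₂ * ε), 0]) = 1 := by
      simp [redCoord, qnorm]
      linear_combination residue R r ^ 2 * residue R h₂ ^ 2 * hε'
    rw [this]
    exact one_ne_zero
  · intro u
    simp [redCoord]
    constructor <;> intro h <;> linear_combination h
  · intro u r
    simp [redCoord]
    constructor <;> intro h
    · linear_combination h - u.re * residue R r * residue R h₂ * hε' -
        residue R r * (u.re - residue R ε * u.imJ) * h2'
    · linear_combination h + u.re * residue R r * residue R h₂ * hε' +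
        residue R r * (u.re - residue R ε * u.imJ) * h2'
  · intro u hu h1 h2
    apply hu
    simp [qnorm]
    linear_combination (u.re + residue R ε * u.imJ) * h1 + u.imJ ^ 2 * hε' +
      (u.imK - residue R ε * u.imI) * h2 - u.imI ^ 2 * hε'
  · intros
    trivial
  · simp [hT, Fin.sum_univ_four, he.1.zero_eq, smul_smul, sub_eq_add_neg, add_assoc]

/-- The suborders of index `p` in a non-maximal order whose residue ring modulo the radical is
split. -/
theorem exists_suborder_of_split {O : Subalgebra R B} {a b : R} {e : Fin 4 → B}
    (he : IsQuasiGoodBasis O a b e) (ha : residue R a = -1) (hb : residue R b = 0)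
    {p α₀ α₁ ε h₂ : R} (hp0 : IsLeftRegular p)
    (hp : ∀ x, residue R x = 0 → ∃ y, x = p * y)
    (hα : α₀ ^ 2 - α₁ ^ 2 = p) (hε : ε ^ 2 = 1) (hs : residue R (α₀ - ε * α₁) = 0)
    (h2 : h₂ * 2 = 1) {d : Fin 4 → B}
    (hd : d = ![1, α₀ • e 1 + α₁ • e 2, α₁ • e 1 + α₀ • e 2, e 3])
    {J : Set ℕ} {r : ℕ → R} (hJ : Set.BijOn (fun i => residue R (r i)) J Set.univ)
    {T : Set B} (hT : T = {y | ∃ i ∈ J, y = 1 + (r i * h₂) • (e 1 - ε • e 2)})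
    {n : ℕ} (hn : Nat.card J = n) :
    ∃ (O' : Subalgebra R B) (h : O' ≤ O),
      Subalgebra.toSubmodule O' = Submodule.span R (Set.range d) ∧
      (unitSubgroup h).index = n ∧ IsRepSystem h T := by
  have hε' : residue R ε ^ 2 = 1 := by rw [← map_pow, hε, map_one]
  have h2' : residue R h₂ * 2 = 1 := by
    rw [← map_ofNat (residue R) 2, ← map_mul, h2, map_one]
  refine exists_suborder he ha hb
    (QuaternionAlgebra.imKₗ _ _ _ + residue R ε • QuaternionAlgebra.imIₗ _ _ _) (by simp) ?_
    ![![1, 0, 0, 0], ![0, α₀, α₁, 0], ![0, α₁, α₀, 0], ![0, 0, 0, 1]] ?_ ?_ ?_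
    (fun i : J => ![1, r i * h₂, -(r i * h₂ * ε), 0]) ?_ ?_ ?_ hn
  · intro x y hx hy
    exact upperTriangular_mul hε' x y hx hy
  · intro i
    fin_cases i <;> simp [hd, Fin.sum_univ_four, he.1.zero_eq]
  · simp only [map_sub, map_mul] at hs
    intro i
    fin_cases i <;> simp [redCoord]
    · linear_combination -hs
    · linear_combination residue R ε * hs + residue R α₁ * hε'
  · intro c hc
    refine exists_coeff_upperTriangular hp0 hp hα hε hs c ?_
    simp [redCoord] at hc
    simp only [map_sub, map_mul]
    linear_combination -hc
  · intro i
    simp [redCoord, qnorm]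
  · intro u hu
    -- For `b = 0` in `k` the norm is `(re - ε imJ)(re + ε imJ)`, so no unit lies over the point at
    -- infinity.
    have hA : u.re - residue R ε * u.imJ ≠ 0 := fun h => hu (by
      simp [qnorm]
      linear_combination (u.re + residue R ε * u.imJ) * h + u.imJ ^ 2 * hε')
    have h (i : J) :
        (u * star (redCoord (-1) 0 ![1, r i * h₂, -(r i * h₂ * ε), 0])).imK + residue R ε *
          (u * star (redCoord (-1) 0 ![1, r i * h₂, -(r i * h₂ * ε), 0])).imI = 0 ↔
        residue R (r i) = -(u.imK + residue R ε * u.imI) / (u.re - residue R ε * u.imJ) := by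
      rw [eq_div_iff hA]
      simp [redCoord]
      constructor <;> intro h
      · linear_combination h - u.re * residue R (r i) * residue R h₂ * hε' -
          residue R (r i) * (u.re - residue R ε * u.imJ) * h2'
      · linear_combination h + u.re * residue R (r i) * residue R h₂ * hε' +
          residue R (r i) * (u.re - residue R ε * u.imJ) * h2'
    exact (existsUnique_congr h).2 (existsUnique_of_bijOn hJ trivial)
  · rw [hT]
    ext y
    simp [Fin.sum_univ_four, he.1.zero_eq, smul_smul, sub_eq_add_neg, add_assoc, eq_comm]

/-- The suborders of index `p ^ 2` in a non-maximal order whose residue ring modulo the radical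
is a quadratic extension of the residue field. -/
theorem exists_suborder_of_inert {O : Subalgebra R B} {a b δ : R} {e : Fin 4 → B}
    (he : IsQuasiGoodBasis O a b e) (ha : residue R a = -residue R δ) (hb : residue R b = 0) {p : R}
    (hp : ∀ x, residue R x = 0 → ∃ y, x = p * y) (hp' : residue R p = 0)
    {d : Fin 4 → B} (hd : d = ![1, p • e 1, p • e 2, e 3])
    {J : Set ℕ} {r : ℕ → R} (hJ : Set.BijOn (fun i => residue R (r i)) J Set.univ)
    {T : Set B} (hT : T = {y | ∃ i ∈ J, ∃ j ∈ J, y = 1 + r i • e 1 + r j • e 2})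
    {n : ℕ} (hn : Nat.card J * Nat.card J = n) :
    ∃ (O' : Subalgebra R B) (h : O' ≤ O),
      Subalgebra.toSubmodule O' = Submodule.span R (Set.range d) ∧
      (unitSubgroup h).index = n ∧ IsRepSystem h T := by
  refine exists_suborder he ha hb
    ((QuaternionAlgebra.imKₗ _ _ _).prod (QuaternionAlgebra.imIₗ _ _ _)) (by simp) ?_
    ![![1, 0, 0, 0], ![0, p, 0, 0], ![0, 0, p, 0], ![0, 0, 0, 1]] ?_ ?_ ?_
    (fun i : J × J => ![1, r i.1, r i.2, 0]) ?_ ?_ ?_ ((Nat.card_prod _ _).trans hn)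
  · intro x y hx hy
    simp at hx hy
    simp [hx, hy]
  · intro i
    fin_cases i <;> simp [hd, Fin.sum_univ_four, he.1.zero_eq]
  · intro i
    fin_cases i <;> simp [redCoord, hp']
  · intro c hc
    have hc' : residue R (c 1) = 0 ∧ residue R (c 2) = 0 := by
      rw [LinearMap.prod_apply, Function.prod_apply, Prod.mk_eq_zero] at hc
      simpa only [redCoord, neg_eq_zero, QuaternionAlgebra.imKₗ_apply,
        QuaternionAlgebra.imIₗ_apply] using hc
    obtain ⟨y, hy⟩ := hp _ hc'.1
    obtain ⟨z, hz⟩ := hp _ hc'.2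
    refine ⟨![c 0, y, z, c 3], fun j => ?_⟩
    fin_cases j <;> simp [Fin.sum_univ_four]
    · linear_combination hy
    · linear_combination hz
  · intro i
    simp [redCoord, qnorm]
  · intro u hu
    -- For `b = 0` in `k` this is the norm of `u`. It is also, up to sign, the determinant of the
    -- linear system for the two parameters, which Cramer's rule solves.
    have hN0 : u.re ^ 2 - residue R δ * u.imJ ^ 2 ≠ 0 := fun h => hu (by simp [qnorm]; linear_combination h)
    have h (i : J × J) : ((QuaternionAlgebra.imKₗ _ _ _).prod (QuaternionAlgebra.imIₗ _ _ _))
        (u * star (redCoord (-residue R δ) 0 ![1, r i.1, r i.2, 0])) = 0 ↔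
        residue R (r i.1) = (-u.imK * u.re - u.imI * u.imJ) / (u.re ^ 2 - residue R δ * u.imJ ^ 2) ∧
        residue R (r i.2) = (u.imI * u.re + residue R δ * u.imK * u.imJ) / (u.re ^ 2 - residue R δ * u.imJ ^ 2) := by
      rw [eq_div_iff hN0, eq_div_iff hN0]
      simp [redCoord]
      constructor <;> rintro ⟨h1, h2⟩ <;> constructor
      · linear_combination u.re * h1 + u.imJ * h2
      · linear_combination -u.re * h2 - residue R δ * u.imJ * h1
      · apply mul_left_cancel₀ hN0
        linear_combination u.re * h1 + u.imJ * h2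
      · apply mul_left_cancel₀ hN0
        linear_combination -u.re * h2 - residue R δ * u.imJ * h1
    simp only [h]
    obtain ⟨i, hi, hi'⟩ := existsUnique_of_bijOn hJ
      (Set.mem_univ ((-u.imK * u.re - u.imI * u.imJ) / (u.re ^ 2 - residue R δ * u.imJ ^ 2)))
    obtain ⟨j, hj, hj'⟩ := existsUnique_of_bijOn hJ
      (Set.mem_univ ((u.imI * u.re + residue R δ * u.imK * u.imJ) / (u.re ^ 2 - residue R δ * u.imJ ^ 2)))
    exact ⟨(i, j), ⟨hi, hj⟩, fun y hy => Prod.ext (hi' _ hy.1) (hj' _ hy.2)⟩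
  · rw [hT]
    ext y
    simp [Fin.sum_univ_four, he.1.zero_eq, eq_comm]

/-- The suborders of index `p ^ 2` in the maximal order of the matrix algebra whose residue ring
modulo the radical is a quadratic extension of the residue field. -/
theorem exists_suborder_inert_of_matrix [Finite (ResidueField R)] (h2 : (2 : ResidueField R) ≠ 0)
    {O : Subalgebra R B} {a b : R} {e : Fin 4 → B}
    (he : IsQuasiGoodBasis O a b e) (ha : residue R a = -1) (hb : residue R b = 1)
    {p δ δ' β₀ β₁ : R} (hp : ∀ x, residue R x = 0 → ∃ y, x = p * y) (hp' : residue R p = 0)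
    (hδ : ¬ IsSquare (residue R δ)) (hδ' : δ' * δ = 1) (hβ : β₀ ^ 2 + β₁ ^ 2 = δ)
    (hβ₁ : residue R β₁ ≠ 0) {d : Fin 4 → B}
    (hd : d = ![1, p • (β₁ • e 1 - β₀ • e 3), p • e 2, β₀ • e 1 + β₁ • e 3])
    {S : Set (ResidueField R × ResidueField R)}
    (hS : S = {t | 1 - residue R δ * t.1 ^ 2 + t.2 ^ 2 ≠ 0})
    {γ : ResidueField R × ResidueField R → R × R}
    (hγ : ∀ t ∈ S, residue R (γ t).1 = t.1 ∧ residue R (γ t).2 = t.2) {T : Set B}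
    (hT : T = {e 2} ∪ {x | ∃ t ∈ S,
      x = 1 + (γ t).1 • (β₁ • e 1 - β₀ • e 3) + (γ t).2 • e 2}) :
    ∃ (O' : Subalgebra R B) (h : O' ≤ O),
      Subalgebra.toSubmodule O' = Submodule.span R (Set.range d) ∧
      (unitSubgroup h).index =
        Nat.card (ResidueField R) * (Nat.card (ResidueField R) - 1) ∧ IsRepSystem h T := by
  have hβ' : residue R β₀ ^ 2 + residue R β₁ ^ 2 = residue R δ := by
    simpa using congrArg (residue R) hβ
  obtain ⟨f, hf⟩ : ∃ f : ℍ[ResidueField R,-1,-(-1)] →ₗ[ResidueField R]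
      ResidueField R × ResidueField R,
      ∀ x, f x = 0 ↔ residue R β₁ * x.imK + residue R β₀ * x.imJ = 0 ∧ x.imI = 0 :=
    ⟨LinearMap.prod (residue R β₁ • QuaternionAlgebra.imKₗ _ _ _ +
      residue R β₀ • QuaternionAlgebra.imJₗ _ _ _) (QuaternionAlgebra.imIₗ _ _ _),
      fun x => Prod.mk_eq_zero⟩
  refine exists_suborder he ha hb
    f (by simp [hf]) ?_
    ![![1, 0, 0, 0], ![0, p * β₁, 0, -(p * β₀)], ![0, 0, p, 0], ![0, β₀, 0, β₁]] ?_ ?_ ?_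
    (fun i : Option S => i.elim ![0, 0, 1, 0]
      fun t => ![1, (γ t).1 * β₁, (γ t).2, -((γ t).1 * β₀)]) ?_ ?_ ?_
    (by rw [Finite.card_option, hS, card_pairs h2 hδ])
  · intro x y hx hy
    rw [hf] at hx hy ⊢
    obtain ⟨hx1, hx2⟩ := hx
    obtain ⟨hy1, hy2⟩ := hy
    simp [hx2, hy2]
    constructor
    · linear_combination x.re * hy1 + y.re * hx1
    · apply mul_left_cancel₀ hβ₁
      linear_combination y.imJ * hx1 - x.imJ * hy1
  · intro i
    fin_cases i <;> simp [hd, Fin.sum_univ_four, he.1.zero_eq]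
    module
  · intro i
    fin_cases i <;> simp [hf, redCoord, hp']
    ring
  · intro c hc
    rw [hf] at hc
    obtain ⟨y, hy⟩ := hp (β₁ * c 1 - β₀ * c 3) (by
      have := hc.1
      simp [redCoord] at this
      simp only [map_sub, map_mul]
      linear_combination -this)
    obtain ⟨z, hz⟩ := hp (c 2) (by simpa [redCoord] using hc.2)
    refine ⟨![c 0, δ' * y, z, δ' * (β₀ * c 1 + β₁ * c 3)], fun j => ?_⟩
    fin_cases j <;> simp [Fin.sum_univ_four]
    · linear_combination (-c 1) * hδ' - δ' * c 1 * hβ + δ' * β₁ * hy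
    · linear_combination hz
    · linear_combination (-c 3) * hδ' - δ' * c 3 * hβ - δ' * β₀ * hy
  · rintro (_ | t)
    · simp [redCoord, qnorm]
    · have ht := hS.subset t.2
      obtain ⟨h1, h2⟩ := hγ _ t.2
      rw [Set.mem_ofPred_eq] at ht
      contrapose! ht
      simp [redCoord, qnorm, h1, h2] at ht
      linear_combination ht + (t : ResidueField R × ResidueField R).1 ^ 2 * hβ'
  · intro u hu
    -- Let `θ` be the image of `β₀e₁ + β₁e₃`, so `θ² = δ` and the subalgebra is the field `k(θ)`.
    -- Write `u = x + y e₂` with `x`, `y` in it: then `x = re + (w/δ)θ` and `y = imI + (v/δ)θ`, and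
    -- the norm of `u` is `N(x) + N(y)`. The representatives are `e₂` and `1 + (t₂ + t₁θ)e₂`, and
    -- the coset of `u` depends only on `y / x`.
    set w := residue R β₁ * u.imJ - residue R β₀ * u.imK with hw
    set v := -(residue R β₁ * u.imK + residue R β₀ * u.imJ) with hv
    have hq : w ^ 2 - residue R δ * u.re ^ 2 + (v ^ 2 - residue R δ * u.imI ^ 2) =
        -(residue R δ * qnorm u) := by
      simp [qnorm, hw, hv, ← hβ']
      ring
    have hδ0 : residue R δ ≠ 0 := by
      intro h
      exact hδ (h ▸ IsSquare.zero)
    have hq0 : -(residue R δ * qnorm u) ≠ 0 := neg_ne_zero.2 (mul_ne_zero hδ0 hu)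
    have h_none : f (u * star (redCoord (-1) 1 ![0, 0, 1, 0])) = 0 ↔ w = 0 ∧ u.re = 0 := by
      simp [hf, redCoord]
      exact fun _ => by rw [hw, sub_eq_add_neg]
    have h_some (t : S) : f (u * star (redCoord (-1) 1 ![1, (γ t).1 * β₁, (γ t).2, -((γ t).1 * β₀)])) = 0 ↔
        u.imI = t.1.1 * w + t.1.2 * u.re ∧ v = t.1.1 * residue R δ * u.re + t.1.2 * w := by
      obtain ⟨h1, h2⟩ := hγ _ t.2
      simp [hf, redCoord, h1, h2]
      constructor <;> rintro ⟨h3, h4⟩ <;> constructor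
      · linear_combination h4 - t.1.1 * hw
      · linear_combination -h3 + hv + t.1.1 * u.re * hβ' - t.1.2 * hw
      · linear_combination -h4 + hv + t.1.1 * u.re * hβ' - t.1.2 * hw
      · linear_combination h3 + t.1.1 * hw
    apply existsUnique_option
    simp only [Option.elim, h_none, h_some]
    -- This is the case `x = 0`, where `u` lies in the coset of `e₂`.
    by_cases h : w ^ 2 - residue R δ * u.re ^ 2 = 0
    · obtain ⟨hw0, hu0⟩ := sq_sub_mul_sq_eq_zero hδ h
      refine Or.inl ⟨⟨hw0, hu0⟩, ?_⟩
      rintro i ⟨hi, hi'⟩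
      apply hq0
      rw [← hq, hi, hi', hw0, hu0]
      ring
    · refine Or.inr ⟨fun h' => h (by rw [h'.1, h'.2]; ring), ?_⟩
      have hsol (t : ResidueField R × ResidueField R) :
          (u.imI = t.1 * w + t.2 * u.re ∧ v = t.1 * residue R δ * u.re + t.2 * w) ↔
          t = ((w * u.imI - u.re * v) / (w ^ 2 - residue R δ * u.re ^ 2),
            (w * v - residue R δ * u.re * u.imI) / (w ^ 2 - residue R δ * u.re ^ 2)) := by
        rw [Prod.ext_iff, eq_div_iff h, eq_div_iff h]
        constructor <;> rintro ⟨h1, h2⟩ <;> constructor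
        · linear_combination -w * h1 + u.re * h2
        · linear_combination -w * h2 + residue R δ * u.re * h1
        · apply mul_left_cancel₀ h
          linear_combination -w * h1 - u.re * h2
        · apply mul_left_cancel₀ h
          linear_combination -w * h2 - residue R δ * u.re * h1
      refine ⟨⟨_, ?_⟩, (hsol _).2 rfl, fun t ht => Subtype.ext ((hsol _).1 ht)⟩
      -- The parameter is `y / x`, and `1 + N(y / x) = N(u) / N(x)` is nonzero.
      rw [hS, Set.mem_ofPred_eq]
      intro h0
      apply hq0
      rw [← hq]
      field_simp at h0
      apply mul_left_cancel₀ h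
      linear_combination h0
  · have h (t : S) : 1 + (γ t).1 • (β₁ • e 1 - β₀ • e 3) + (γ t).2 • e 2 =
        ∑ j, ![1, (γ t).1 * β₁, (γ t).2, -((γ t).1 * β₀)] j • e j := by
      simp [Fin.sum_univ_four, he.1.zero_eq]
      module
    rw [hT]
    ext y
    simp only [Set.mem_range, Option.exists, Option.elim, ← h]
    simp [Fin.sum_univ_four, eq_comm]

end Suborders

end BassOrder

/-! ### The rows of the table -/

open IsLocalRing BassOrder in
theorem mainTheorem9 {R K B : Type*}
    -- the complete local ring, its fraction field, and a quaternion algebra over it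
    [CommRing R] [IsDomain R] [IsDiscreteValuationRing R]
    [IsAdicComplete (IsLocalRing.maximalIdeal R) R]
    [Finite (IsLocalRing.ResidueField R)] (h_odd : (2 : R) ∉ IsLocalRing.maximalIdeal R)
    [Field K] [Algebra R K] [IsFractionRing R K]
    [Ring B] [Algebra K B] [Algebra R B] [IsScalarTower R K B]
    [Algebra.IsCentral K B] [IsSimpleRing B] (h_dim : Module.finrank K B = 4)
    -- the auxiliary elements, the representatives of the residue classes, and the lifts of pairs
    (P : BassOrder.Params R) (hP : P.Valid)
    (q : ℕ) (hq : q = Nat.card (IsLocalRing.ResidueField R))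
    (a : ℕ → R) (ha : Set.BijOn (fun i => IsLocalRing.residue R (a i)) (Set.Icc 1 q) Set.univ)
    (ha_one : a 1 = 1) (ha_two : a 2 = -1) (ha_last : a q = 0)
    (γ : IsLocalRing.ResidueField R × IsLocalRing.ResidueField R → R × R)
    (hγ : ∀ t ∈ BassOrder.pairSet P,
      IsLocalRing.residue R (γ t).1 = t.1 ∧ IsLocalRing.residue R (γ t).2 = t.2)
    -- a row of the table, and an order with a quasi-good basis for the upper form of that row
    (r : BassOrder.Row) (hr : r.Occurs R)
    (O : Subalgebra R B) (hO : BassOrder.IsOrder K O)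
    (e : Fin 4 → B) (he : BassOrder.IsQuasiGoodBasis O (r.top P).1 (r.top P).2 e) :
    ∃ (O' : Subalgebra R B) (h : O' ≤ O),
      Subalgebra.toSubmodule O' = Submodule.span R (Set.range (r.d K P e)) ∧
      (BassOrder.unitSubgroup h).index = r.unitIndex q ∧
      BassOrder.IsRepSystem h (r.reps K P q a γ e) := by

  obtain ⟨hπ, hδ, hα, hε, hs, hβ, hμ, hν⟩ := hP
  have hp0 : IsLeftRegular P.π := (IsRegular.of_ne_zero hπ.ne_zero).left
  have hp (x : R) (hx : residue R x = 0) : ∃ y, x = P.π * y := by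
    rw [residue_eq_zero_iff, hπ.maximalIdeal_eq, Ideal.mem_span_singleton] at hx
    exact hx
  have hp' : residue R P.π = 0 := by
    rw [residue_eq_zero_iff, hπ.maximalIdeal_eq]
    exact Ideal.mem_span_singleton_self _
  have hε2 : P.ε ^ 2 = 1 := by rcases hε with h | h <;> rw [h] <;> ring
  have hs' : residue R (P.α₀ - P.ε * P.α₁) = 0 := (residue_eq_zero_iff _).2 hs
  have h2 : (2 : ResidueField R) ≠ 0 := by
    rw [← map_ofNat (residue R) 2, ne_eq, residue_eq_zero_iff]
    exact h_odd
  obtain ⟨h₂, hh₂⟩ : ∃ h₂ : R, h₂ * 2 = 1 :=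
    exists_mul_eq_one_of_residue_ne_zero (by rwa [map_ofNat])
  have hδ0 : residue R P.δ ≠ 0 := fun h => hδ (h ▸ IsSquare.zero)
  obtain ⟨δ', hδ'⟩ := exists_mul_eq_one_of_residue_ne_zero hδ0
  -- Otherwise `δ` would reduce to the square of `β₀`.
  have hβ₁ : residue R P.β₁ ≠ 0 := fun h => hδ ⟨residue R P.β₀, by
    rw [← hβ, map_add, map_pow, map_pow, h]; ring⟩
  have hdiv (x : R) (y : B) : (algebraMap R K x / 2) • y = (x * h₂) • y := by
    have h2K : (2 : K)⁻¹ = algebraMap R K h₂ := by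
      refine inv_eq_of_mul_eq_one_left ?_
      rw [← map_ofNat (algebraMap R K) 2, ← map_mul, hh₂, map_one]
    rw [div_eq_mul_inv, h2K, ← map_mul, algebraMap_smul]
  have hq2 : 2 ≤ q := by
    rw [hq]
    have := Fintype.ofFinite (ResidueField R)
    rw [Nat.card_eq_fintype_card]
    exact Fintype.one_lt_card
  -- For `q = 2` the conditions on the second and on the last representative would give `-1 = 0`.
  have hq3 : 3 ≤ q := by
    rcases hq2.lt_or_eq with h | h
    · exact h
    · rw [← h, ha_two] at ha_last
      simp at ha_last
  have hJ3 := bijOn_residue_three hq3 ha (by simp [ha_one]) (by simp [ha_two])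
  have hJ0 := bijOn_residue_ne_zero (by omega) ha (by simp [ha_last])
  -- As `δ` is not a square in `k`, `s² - δ` has no root and no residue is left out.
  have hJδ : Set.BijOn (fun i => residue R (a i)) (Set.Icc 1 q)
      {s | s ^ 2 + -residue R P.δ ≠ 0} := by
    convert! ha using 1
    refine Set.eq_univ_of_forall fun s h => hδ ⟨s, ?_⟩
    linear_combination -h
  have hJ0' : Set.BijOn (fun i => residue R (a i)) (Set.Icc 1 (q - 1))
      {s | s ^ 2 + 0 ≠ 0} := by simpa using hJ0
  have hμ' (h : IsSquare (-1 : ResidueField R)) : -P.μ * P.μ = 1 := by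
    linear_combination -hμ h
  have hν' (h : ¬ IsSquare (-1 : ResidueField R)) : ∃ ν', ν' * P.ν = 1 :=
    ⟨-δ' * P.ν, by linear_combination hδ' - δ' * hν h⟩
  have card1 : Nat.card (Set.Icc 1 q) = q := by simp
  have card2 : Nat.card (Set.Icc 1 q) + 1 = q + 1 := by simp
  have card3 : Nat.card (Set.Icc 3 q) + 1 = q - 1 := by simp; omega
  have card4 : Nat.card (Set.Icc 1 (q - 1)) + 1 = q := by simp; omega
  have fin1 := Set.finite_Icc 1 q
  have fin3 := Set.finite_Icc 3 q
  have fin4 := Set.finite_Icc 1 (q - 1)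
  cases r with
  | A1A1 s =>
    cases s with
    | zero =>
      exact exists_suborder_of_matrix he (by simp [Row.top]) (by simp [Row.top]) hp0 hp hα hε2 hs'
        hh₂ rfl ha (by simp only [Row.reps, hdiv]) fin1 card2
    | succ s =>
      exact exists_suborder_of_split he (by simp [Row.top]) (by simp [Row.top, hp']) hp0 hp hα hε2
        hs' hh₂ rfl ha (by simp only [Row.reps, hdiv]) card1
  | A1A2 =>
    subst hq
    exact exists_suborder_inert_of_matrix h2 he (by simp [Row.top]) (by simp [Row.top]) hp hp' hδ
      hδ' hβ hβ₁ rfl rfl hγ rfl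
  | A1B =>
    exact exists_suborder_span_one_two he (by simp [Row.top]) (by simp [Row.top, hp']) hp hp'
      (hμ' hr) (hμ' hr) rfl hJ3 rfl fin3 card3
  | A1B' =>
    obtain ⟨ν', h⟩ := hν' hr
    exact exists_suborder_span_one_two he (by simp [Row.top]) (by simp [Row.top, hp']) hp hp'
      h h rfl hJ3 rfl fin3 card3
  | A2A2 s =>
    exact exists_suborder_of_inert (δ := P.δ) he (by simp [Row.top])
      (by simp [Row.top, hp', Nat.one_le_iff_ne_zero.1 hr]) hp hp' rfl ha rfl
      (by rw [card1]; exact (sq q).symm)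
  | A2B =>
    exact exists_suborder_span_one_two he (by simp [Row.top]) (by simp [Row.top, hp']) hp hp'
      (hμ' hr) (hμ' hr) rfl hJδ rfl fin1 card2
  | A2B' =>
    obtain ⟨ν', h⟩ := hν' hr
    rw [mul_comm] at h
    exact exists_suborder_span_one_two he (by simp [Row.top]) (by simp [Row.top, hp']) hp hp'
      h h (by simp only [Row.d, inv_algebraMap_smul ((mul_comm _ _).trans h), smul_smul])
      hJδ rfl fin1 card2
  | BC₁ =>
    exact exists_suborder_span_one_three_of_nilpotent he hp' hp' hp hp' (mul_one 1) (mul_one 1)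
      (by simp [Row.d]) hJ0 rfl fin4 card4
  | BC₂ =>
    exact exists_suborder_rotated_of_nilpotent he hp' hp' hp hp' hβ hδ' hβ₁ rfl hJ0 rfl fin4 card4
  | BC₃ =>
    exact exists_suborder_span_one_three_of_nilpotent he hp' (by simp [Row.top, hp']) hp hp' (mul_one 1)
      (mul_one 1) (by simp [Row.d]) hJ0 rfl fin4 card4
  | BC₄ =>
    -- Here the shrunken direction is `e₃`, as in the rows ending in B; with `α = 0` the only
    -- excluded residue is 0.
    exact exists_suborder_span_one_two he hp' (by simp [Row.top, hp']) hp hp' hδ' (mul_one 1)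
      (by simp [Row.d]) hJ0' rfl fin4 card4
  | CC₁ s =>
    have hs0 : s ≠ 0 := by rintro rfl; exact absurd hr (by simp [Row.Occurs])
    exact exists_suborder_span_one_three_of_nilpotent he hp' (by simp [Row.top, hp', hs0]) hp hp' (mul_one 1)
      (mul_one 1) (by simp [Row.d]) hJ0 rfl fin4 card4
  | CC₂ s =>
    have hs0 : s ≠ 0 := by rintro rfl; exact absurd hr (by simp [Row.Occurs])
    exact exists_suborder_span_one_three_of_nilpotent he (by simp [Row.top, hp']) (by simp [Row.top, hp', hs0])
      hp hp' hδ' (mul_one 1) (by simp [Row.d]) hJ0 rfl fin4 card4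
  | CC₃ s =>
    have hs0 : s ≠ 0 := by rintro rfl; exact absurd hr (by simp [Row.Occurs])
    exact exists_suborder_span_one_three_of_nilpotent he hp' (by simp [Row.top, hp', hs0]) hp hp' (mul_one 1)
      (mul_one 1) (by simp [Row.d]) hJ0 rfl fin4 card4
  | CC₄ s =>
    have hs0 : s ≠ 0 := by rintro rfl; exact absurd hr (by simp [Row.Occurs])
    exact exists_suborder_span_one_three_of_nilpotent he (by simp [Row.top, hp']) (by simp [Row.top, hp', hs0])
      hp hp' hδ' ((mul_comm _ _).trans hδ') (by simp only [Row.d, inv_algebraMap_smul hδ'])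
      hJ0 rfl fin4 card4
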